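/- Let $K\ge 2$, let $\boldsymbol{\mu}=(\mu_1,\dots,\mu_K)\in[0,1]^K$ be drawn from a prior probability distribution $H$, and write $\boldsymbol{\mu}_{\setminus i}$ (resp. $\boldsymbol{\mu}_{\setminus ij}$) for the parameters other than $\mu_i$ (resp. $\mu_i,\mu_j$), $H_{\setminus i}$ for the law of $\boldsymbol{\mu}_{\setminus i}$, $\mu^*=\max_i\mu_i$ and $\mu^*_{\setminus i}=\max_{j\ne i}\mu_j$. Assume that there are conditional probability densities (with respect to Lebesgue measure on $[0,1]$, resp. $[0,1]^2$) $h_i(\mu_i|\boldsymbol{\mu}_{\setminus i})$ of $\mu_i$ given $\boldsymbol{\mu}_{\setminus i}$ and $h_{ij}(\mu_i,\mu_j|\boldsymbol{\mu}_{\setminus ij})$ of $(\mu_i,\mu_j)$ given $\boldsymbol{\mu}_{\setminus ij}$, for all $i\neq j$, that are uniformly continuous: for every $\epsilon>0$ there is $\delta>0$, not depending on the parameters, such that $|h_i(\mu_i|\boldsymbol{\mu}_{\setminus i})-h_i(\lambda_i|\boldsymbol{\mu}_{\setminus i})|\le\epsilon$ whenever $|\mu_i-\lambda_i|\le\delta$,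 and $|h_{ij}(\mu_i,\mu_j|\boldsymbol{\mu}_{\setminus ij})-h_{ij}(\lambda_i,\lambda_j|\boldsymbol{\mu}_{\setminus ij})|\le\epsilon$ whenever $|\mu_i-\lambda_i|,|\mu_j-\lambda_j|\le\delta$. Given $\boldsymbol{\mu}$, the rewards of all draws of all arms are independent, those of arm $i$ being Bernoulli with mean $\mu_i$. Fix a constant $q\in(0,1)$. With a budget of $T$ rounds, the Two-Stage Exploration algorithm draws each arm $\lfloor qT/K\rfloor$ times; with $\hat\mu_i$ the resulting empirical means and $B=\sqrt{K\log T/(qT)}$, it forms the set of candidates $\hat{\mathcal J}=\{i:\hat\mu_i+B\ge\max_j(\hat\mu_j-B)\}$. If $\hat{\mathcal J}$ has only one element, it returns that arm as $J(T)$. Otherwise it draws each arm of $\hat{\mathcal J}$ another $\lfloor(1-q)T/|\hat{\mathcal J}|\rfloor$ times and returns an arm $J(T)\in\hat{\mathcal J}$ that has, among the arms of $\hat{\mathcal J}$, the largest empirical mean over all its draws in both stages, ties being broken arbitrarily. Then the Bayesian simple regret $R_H(T)=\mathbb E_{\boldsymbol{\mu}\sim H}\bigl[\mu^*-\mathbb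 E_{\boldsymbol{\mu}}[\mu_{J(T)}]\bigr]$ of this algorithm satisfies, as $T\to\infty$, \[ R_H(T)\le\frac{C_{\mathrm{opt}}}{T'}+o\Bigl(\frac1T\Bigr),\qquad C_{\mathrm{opt}}=\sum_{i=1}^K\int_{[0,1]^{K-1}}\mu^*_{\setminus i}(1-\mu^*_{\setminus i})\,h_i(\mu^*_{\setminus i}|\boldsymbol{\mu}_{\setminus i})\,dH_{\setminus i}(\boldsymbol{\mu}_{\setminus i}),\qquad T'=\Bigl(\frac qK+1-q\Bigr)T, \] where the integrals that define $C_{\mathrm{opt}}$ and $R_H(T)$ exist. -/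

import Mathlib

open MeasureTheory ProbabilityTheory Filter Asymptotics
open scoped unitInterval Topology

noncomputable section

namespace TSE

/-! ### Conditional densities and the continuity assumption on the prior -/

/-- `h x y` is a conditional probability density, with respect to the measure `ν`, of the random
element `X` given the random element `Y` under the law `H`: it is measurable, non-negative, and
the joint law of `(Y, X)` is `h x y dν(x) dH_Y(y)`, where `H_Y` is the law of `Y`. -/
structure IsCondDensity {Ω α β : Type*} [MeasurableSpace Ω] [MeasurableSpace α]
    [MeasurableSpace β] (H : Measure Ω) (X : Ω → α) (Y : Ω → β) (ν : Measure α)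
    (h : α → β → ℝ) : Prop where
  measurable : Measurable (fun p : α × β => h p.1 p.2)
  nonneg : ∀ x y, 0 ≤ h x y
  joint : H.map (fun ω => (Y ω, X ω)) =
    ((H.map Y).prod ν).withDensity (fun p => ENNReal.ofReal (h p.2 p.1))

/-- All parameters other than that of arm `i`. -/
def except {K : ℕ} (i : Fin K) (μ : Fin K → I) : {j : Fin K // j ≠ i} → I :=
  fun j => μ j

/-- All parameters other than those of arms `i` and `j`. -/
def except₂ {K : ℕ} (i j : Fin K) (μ : Fin K → I) : {k : Fin K // k ≠ i ∧ k ≠ j} → I :=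
  fun k => μ k

/-- `h i` is a conditional density of `μ_i` given the other parameters, `h₂ i j` (for `i ≠ j`) is a
conditional joint density of `(μ_i, μ_j)` given the other parameters, both with respect to Lebesgue
measure, and these densities are continuous in `μ_i`, resp. in `(μ_i, μ_j)`, uniformly in all the
parameters. -/
structure UniformlyContinuousDensities {K : ℕ} (H : Measure (Fin K → I))
    (h : (i : Fin K) → I → ({j : Fin K // j ≠ i} → I) → ℝ)
    (h₂ : (i j : Fin K) → I × I → ({k : Fin K // k ≠ i ∧ k ≠ j} → I) → ℝ) : Prop where
  density : ∀ i, IsCondDensity H (fun μ => μ i) (except i) volume (h i)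
  density₂ : ∀ i j, i ≠ j →
    IsCondDensity H (fun μ => (μ i, μ j)) (except₂ i j) volume (h₂ i j)
  unifCont : ∀ ε > (0 : ℝ), ∃ δ > (0 : ℝ), ∀ i y, ∀ x x' : I,
    |(x : ℝ) - x'| ≤ δ → |h i x y - h i x' y| ≤ ε
  unifCont₂ : ∀ ε > (0 : ℝ), ∃ δ > (0 : ℝ), ∀ i j, i ≠ j → ∀ y, ∀ x x' z z' : I,
    |(x : ℝ) - x'| ≤ δ → |(z : ℝ) - z'| ≤ δ → |h₂ i j (x, z) y - h₂ i j (x', z') y| ≤ ε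

/-! ### Rewards -/

/-- The rewards of the arms for the horizon `T`: `ω i s` is the reward (`true` for `1`, `false` for
`0`) of the draw number `s + 1` of arm `i`. No arm is drawn more than `T` times. -/
abbrev Rewards (K T : ℕ) : Type := Fin K → Fin T → Bool

/-- The law of the rewards for the parameters `μ`: all rewards are independent, and those of arm `i`
are Bernoulli with mean `μ i`. -/
def rewardLaw {K : ℕ} (T : ℕ) (μ : Fin K → I) : Measure (Rewards K T) :=
  Measure.pi fun i => Measure.pi fun _ => bernoulliMeasure true false (μ i)

/-- The empirical mean of the first `n` draws of arm `i`. -/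
def empMean {K T : ℕ} (ω : Rewards K T) (i : Fin K) (n : ℕ) : ℝ :=
  ((Finset.univ.filter fun s : Fin T => (s : ℕ) < n ∧ ω i s = true).card : ℝ) / n

/-! ### The Two-Stage Exploration algorithm -/

/-- The number of draws of each arm in the first stage, `qT/K` rounded down. -/
def firstDraws (K : ℕ) (q : ℝ) (T : ℕ) : ℕ := ⌊q * T / K⌋₊

/-- The number of draws of each of the `m` candidates in the second stage, `(1-q)T/m` rounded
down. -/
def secondDraws (q : ℝ) (T m : ℕ) : ℕ := ⌊(1 - q) * T / m⌋₊

/-- The half width of the confidence intervals. -/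
def confWidth (K : ℕ) (q : ℝ) (T : ℕ) : ℝ := √(K * Real.log T / (q * T))

/-- The lower confidence bound of arm `i` after the first stage. -/
def lowerBound {K T : ℕ} (q : ℝ) (ω : Rewards K T) (i : Fin K) : ℝ :=
  empMean ω i (firstDraws K q T) - confWidth K q T

/-- The upper confidence bound of arm `i` after the first stage. -/
def upperBound {K T : ℕ} (q : ℝ) (ω : Rewards K T) (i : Fin K) : ℝ :=
  empMean ω i (firstDraws K q T) + confWidth K q T

open Classical in
/-- The candidates: the arms whose upper confidence bound is at least the largest lower confidence
bound. -/
def candidates {K T : ℕ} (q : ℝ) (ω : Rewards K T) : Finset (Fin K) :=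
  Finset.univ.filter fun i => ∀ j, lowerBound q ω j ≤ upperBound q ω i

/-- The empirical mean of a candidate `i` at the end of the second stage, over all the draws of this
arm in both stages. -/
def finalMean {K T : ℕ} (q : ℝ) (ω : Rewards K T) (i : Fin K) : ℝ :=
  empMean ω i (firstDraws K q T + secondDraws q T (candidates q ω).card)

/-- `J` is the recommendation of the Two-Stage Exploration algorithm with parameter `q` and horizon
`T`: the candidate if there is only one, and otherwise a candidate whose final empirical mean is the
largest among the candidates. Ties are broken in an arbitrary way. -/
def IsRecommendation {K T : ℕ} (q : ℝ) (J : Rewards K T → Fin K) : Prop :=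
  ∀ ω, J ω ∈ candidates q ω ∧
    ((candidates q ω).card ≠ 1 → ∀ j ∈ candidates q ω, finalMean q ω j ≤ finalMean q ω (J ω))

/-! ### Simple regret -/

/-- The largest of finitely many parameters (used for non-empty families only). -/
def best {ι : Type*} [Fintype ι] (μ : ι → I) : I := Finset.univ.sup μ

/-- The simple regret, for the parameters `μ`, of the recommendation `J`. -/
def regret {K T : ℕ} (J : Rewards K T → Fin K) (μ : Fin K → I) : ℝ :=
  (best μ : ℝ) - ∫ ω, (μ (J ω) : ℝ) ∂(rewardLaw T μ)

/-- The Bayesian simple regret, for the prior `H`, of the recommendation `J`. -/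
def bayesRegret {K T : ℕ} (H : Measure (Fin K → I)) (J : Rewards K T → Fin K) : ℝ :=
  ∫ μ, regret J μ ∂H

/-- The integrand of the `i`-th term of the constant: `μ* (1 - μ*) h_i(μ* | y)`, where `μ*` is the
largest of the parameters `y` of the arms other than `i`. -/
def optIntegrand {K : ℕ} (h : (i : Fin K) → I → ({j : Fin K // j ≠ i} → I) → ℝ) (i : Fin K)
    (y : {j : Fin K // j ≠ i} → I) : ℝ :=
  (best y : ℝ) * (1 - (best y : ℝ)) * h i (best y) y

/-- The leading constant: the sum over the arms `i` of the integrals of `optIntegrand h i` with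
respect to the law of the parameters other than `μ_i`. -/
def optConst {K : ℕ} (H : Measure (Fin K → I))
    (h : (i : Fin K) → I → ({j : Fin K // j ≠ i} → I) → ℝ) : ℝ :=
  ∑ i, ∫ y, optIntegrand h i y ∂(H.map (except i))

/-- The effective horizon `T' = (q/K + (1 - q)) T`. -/
def effHorizon (K : ℕ) (q : ℝ) (T : ℕ) : ℝ := (q / K + (1 - q)) * T

end TSE

end

/-! Write `B` for the confidence width, so that `B²` has order `log T / T`. The regret for fixed
parameters is split into three contributions.

Some first-stage confidence interval fails. By Hoeffding and a union bound this has probability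
`O(T^(-3/2))`, and the loss is at most `1` (`rewardLaw_real_badEvent_le`). Otherwise every candidate
is within `4B` of the best arm, and the best arm is a candidate.

Two arms are within `4B` of a third one. Off the bad event the loss is still at most `4B`, and a
bounded joint density of two arms gives such parameters prior mass `O(B²)`. The product `O(B³)` is
`o(1/T)`.

In the remaining case only the best and the second best arm can be candidates, and an error requires
both. Each then has `n = ⌊qT/K⌋ + ⌊(1-q)T/2⌋` draws, and the expected loss is at most the gap times
the probability that the worse arm has at least as many successes (`pairLoss`). Conditionally on the
other arms, with `z` the largest of their means, only means `x` of arm `i` within `4B` of `z`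
matter. There the density is nearly `h i z y`, and it remains to integrate `pairLoss n x z` over
uniform `x`. The result is at most `(z(1-z) + O(n^(-1/2)))/n` (`lintegral_pairLoss_le`), obtained
from exact Beta integrals instead of a normal approximation.

Summing over `i` counts each comparison of the two best arms twice, whence a factor `1/2`
(`regret_le`). The main term is thus `optConst / (2n)`, and `2n` is at least the effective horizon
once `T` is large. -/

namespace TSE

/-! ### Binomial weights -/

/-- The probability that a binomial variable with parameters `n` and `x` equals `k`. -/
noncomputable def binomWeight (n k : ℕ) (x : ℝ) : ℝ := n.choose k * x ^ k * (1 - x) ^ (n - k)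

lemma binomWeight_eq_eval (n k : ℕ) (x : ℝ) :
    binomWeight n k x = (bernsteinPolynomial ℝ n k).eval x := by
  simp [binomWeight, bernsteinPolynomial]

lemma binomWeight_nonneg (n k : ℕ) {x : ℝ} (h0 : 0 ≤ x) (h1 : x ≤ 1) : 0 ≤ binomWeight n k x := by
  have : 0 ≤ 1 - x := by linarith
  unfold binomWeight; positivity

@[fun_prop]
lemma continuous_binomWeight (n k : ℕ) : Continuous (binomWeight n k) := by
  unfold binomWeight; fun_prop

lemma sum_binomWeight (n : ℕ) (x : ℝ) : ∑ k ∈ Finset.range (n + 1), binomWeight n k x = 1 := by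
  have := congrArg (Polynomial.eval x) (bernsteinPolynomial.sum ℝ n)
  simpa [Polynomial.eval_finsetSum, ← binomWeight_eq_eval] using this

lemma sum_mul_binomWeight (n : ℕ) (x : ℝ) :
    ∑ k ∈ Finset.range (n + 1), (k : ℝ) * binomWeight n k x = n * x := by
  have := congrArg (Polynomial.eval x) (bernsteinPolynomial.sum_smul ℝ n)
  simpa [Polynomial.eval_finsetSum, ← binomWeight_eq_eval] using this

lemma sum_sq_mul_binomWeight (n : ℕ) (x : ℝ) :
    ∑ k ∈ Finset.range (n + 1), (k : ℝ) ^ 2 * binomWeight n k x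
      = n * x * (1 - x) + (n * x) ^ 2 := by
  have := congrArg (Polynomial.eval x) (bernsteinPolynomial.variance ℝ n)
  simp only [Polynomial.eval_finsetSum, Polynomial.eval_mul, Polynomial.eval_pow,
    Polynomial.eval_sub, ← binomWeight_eq_eval, Polynomial.eval_X,
    Polynomial.eval_natCast, Polynomial.eval_one, nsmul_eq_mul] at this
  have e : ∀ k ∈ Finset.range (n + 1), (n * x - (k : ℝ)) ^ 2 * binomWeight n k x
      = (n * x) ^ 2 * binomWeight n k x - 2 * (n * x) * (k * binomWeight n k x)
        + (k : ℝ) ^ 2 * binomWeight n k x := fun k _ => by ring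
  rw [Finset.sum_congr rfl e, Finset.sum_add_distrib, Finset.sum_sub_distrib, ← Finset.mul_sum,
    ← Finset.mul_sum, sum_binomWeight, sum_mul_binomWeight] at this
  linarith

/-! ### Beta integrals of the binomial weights -/

lemma hasDerivAt_binomWeight_succ (n k : ℕ) (x : ℝ) :
    HasDerivAt (binomWeight (n + 1) (k + 1))
      ((n + 1) * (binomWeight n k x - binomWeight n (k + 1) x)) x := by
  have h := (bernsteinPolynomial ℝ (n + 1) (k + 1)).hasDerivAt x
  rw [bernsteinPolynomial.derivative_succ_aux] at h
  have e : binomWeight (n + 1) (k + 1)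
      = fun x => (bernsteinPolynomial ℝ (n + 1) (k + 1)).eval x :=
    funext fun x => binomWeight_eq_eval _ _ x
  rw [e]
  exact h.congr_deriv (by simp [binomWeight_eq_eval])

/-- The difference of the two integrands is, up to the factor `n + 1`, the derivative of a weight of
degree `n + 1` that vanishes at both endpoints; `k < n` is what makes it vanish at `1`. -/
lemma integral_binomWeight_succ (n k : ℕ) (hk : k < n) :
    ∫ x in (0 : ℝ)..1, binomWeight n (k + 1) x = ∫ x in (0 : ℝ)..1, binomWeight n k x := by
  have hi : ∀ j, IntervalIntegrable (binomWeight n j) volume 0 1 :=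
    fun j => (continuous_binomWeight n j).intervalIntegrable _ _
  have h := intervalIntegral.integral_eq_sub_of_hasDerivAt
    (fun x _ => hasDerivAt_binomWeight_succ n k x)
    ((((hi k).sub (hi (k + 1))).const_mul ((n : ℝ) + 1)))
  rw [intervalIntegral.integral_const_mul, intervalIntegral.integral_sub (hi _) (hi _)] at h
  have h0 : binomWeight (n + 1) (k + 1) 0 = 0 := by simp [binomWeight]
  have h1 : binomWeight (n + 1) (k + 1) 1 = 0 := by
    have : n - k ≠ 0 := by omega
    simp [binomWeight, this]
  rw [h0, h1, sub_zero, mul_eq_zero] at h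
  rcases h with h | h
  · have : (0 : ℝ) < n + 1 := by positivity
    linarith
  · linarith

/-- The `n + 1` weights have equal integrals and add up to `1`. -/
lemma integral_binomWeight (n k : ℕ) (hk : k ≤ n) :
    ∫ x in (0 : ℝ)..1, binomWeight n k x = 1 / (n + 1) := by
  have hc : ∀ j ≤ n, ∫ x in (0 : ℝ)..1, binomWeight n j x
      = ∫ x in (0 : ℝ)..1, binomWeight n 0 x := by
    intro j
    induction j with
    | zero => intro _; rfl
    | succ j ih => intro hj; rw [integral_binomWeight_succ n j (by omega), ih (by omega)]
  have hs : ∑ j ∈ Finset.range (n + 1), ∫ x in (0 : ℝ)..1, binomWeight n j x = 1 := by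
    rw [← intervalIntegral.integral_finsetSum
      (fun j _ => (continuous_binomWeight n j).intervalIntegrable _ _)]
    simp [sum_binomWeight]
  rw [Finset.sum_congr rfl (fun j hj => hc j (by simpa [Nat.lt_succ_iff] using hj))] at hs
  simp at hs
  rw [hc k hk]
  field_simp
  linarith

/-- Absorbing a factor `x` into the weight reduces the moments in `x` to plain integrals of weights
of higher degree. -/
lemma mul_binomWeight (n k : ℕ) (x : ℝ) :
    x * binomWeight n k x = (k + 1) / (n + 1) * binomWeight (n + 1) (k + 1) x := by
  have h : ((n : ℝ) + 1) * n.choose k = (n + 1).choose (k + 1) * (k + 1) := by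
    exact_mod_cast Nat.add_one_mul_choose_eq n k
  have hn : (n : ℝ) + 1 ≠ 0 := by positivity
  rw [binomWeight, binomWeight, Nat.add_sub_add_right, div_mul_eq_mul_div, eq_div_iff hn]
  linear_combination (x ^ (k + 1) * (1 - x) ^ (n - k)) * h

lemma integral_mul_binomWeight (n k : ℕ) (hk : k ≤ n) :
    ∫ x in (0 : ℝ)..1, x * binomWeight n k x = (k + 1) / ((n + 1) * (n + 2)) := by
  simp_rw [mul_binomWeight]
  rw [intervalIntegral.integral_const_mul, integral_binomWeight _ _ (by omega)]
  push_cast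
  field_simp
  ring

lemma integral_sq_mul_binomWeight (n k : ℕ) (hk : k ≤ n) :
    ∫ x in (0 : ℝ)..1, x ^ 2 * binomWeight n k x
      = (k + 1) * (k + 2) / ((n + 1) * (n + 2) * (n + 3)) := by
  simp_rw [sq, mul_assoc, mul_binomWeight, mul_left_comm _ (((k : ℝ) + 1) / (n + 1))]
  rw [intervalIntegral.integral_const_mul, integral_mul_binomWeight _ _ (by omega)]
  push_cast
  field_simp
  ring

lemma integral_sub_mul_sum_binomWeight (n k : ℕ) (hk : k ≤ n) (z : ℝ) :
    ∫ x in (0 : ℝ)..1, (x - z) * ∑ l ∈ Finset.range (k + 1), binomWeight n l x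
      = (k + 1) * (k + 2) / (2 * (n + 1) * (n + 2)) - z * (k + 1) / (n + 1) := by
  simp_rw [Finset.mul_sum]
  rw [intervalIntegral.integral_finsetSum (fun l _ => by
    apply Continuous.intervalIntegrable; fun_prop)]
  have hl : ∀ l ∈ Finset.range (k + 1), ∫ x in (0 : ℝ)..1, (x - z) * binomWeight n l x
      = (l + 1) / ((n + 1) * (n + 2)) - z / (n + 1) := by
    intro l hl
    have hl : l ≤ n := by simp at hl; omega
    simp_rw [sub_mul]
    rw [intervalIntegral.integral_sub (by apply Continuous.intervalIntegrable; fun_prop)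
      (by apply Continuous.intervalIntegrable; fun_prop), intervalIntegral.integral_const_mul,
      integral_mul_binomWeight n l hl, integral_binomWeight n l hl]
    ring
  rw [Finset.sum_congr rfl hl, Finset.sum_sub_distrib, ← Finset.sum_div, Finset.sum_add_distrib]
  have hg : ∑ l ∈ Finset.range (k + 1), (l : ℝ) = k * (k + 1) / 2 := by
    clear hl hk
    induction k with
    | zero => simp
    | succ k ih => rw [Finset.sum_range_succ, ih]; push_cast; ring
  rw [hg]
  simp
  field_simp

lemma integral_quadratic_mul_binomWeight (n k : ℕ) (hk : k ≤ n) (z θ : ℝ) :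
    ∫ x in (0 : ℝ)..1, (θ + (x - z) ^ 2 / θ) / 2 * binomWeight n k x
      = (θ + ((k + 1) * (k + 2) / ((n + 2) * (n + 3)) - 2 * z * (k + 1) / (n + 2) + z ^ 2) / θ)
        / (2 * (n + 1)) := by
  have e : ∀ x, (θ + (x - z) ^ 2 / θ) / 2 * binomWeight n k x
      = (θ + z ^ 2 / θ) / 2 * binomWeight n k x - z / θ * (x * binomWeight n k x)
        + 1 / (2 * θ) * (x ^ 2 * binomWeight n k x) := by intro x; ring
  simp_rw [e]
  rw [intervalIntegral.integral_add, intervalIntegral.integral_sub,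
    intervalIntegral.integral_const_mul, intervalIntegral.integral_const_mul,
    intervalIntegral.integral_const_mul, integral_binomWeight n k hk,
    integral_mul_binomWeight n k hk, integral_sq_mul_binomWeight n k hk]
  · rcases eq_or_ne θ 0 with rfl | hθ
    · simp
    field_simp
    ring
  all_goals apply Continuous.intervalIntegrable; fun_prop

lemma integral_max_sub_zero {z : ℝ} (h0 : 0 ≤ z) (h1 : z ≤ 1) :
    ∫ x in (0 : ℝ)..1, max (z - x) 0 = z ^ 2 / 2 := by
  rw [← intervalIntegral.integral_add_adjacent_intervals (b := z)
    (by apply Continuous.intervalIntegrable; fun_prop)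
    (by apply Continuous.intervalIntegrable; fun_prop)]
  have e1 : ∫ x in (0 : ℝ)..z, max (z - x) 0 = ∫ x in (0 : ℝ)..z, (z - x) := by
    apply intervalIntegral.integral_congr
    intro x hx
    rw [Set.uIcc_of_le h0] at hx
    exact max_eq_left (by linarith [hx.2])
  have e2 : ∫ x in z..1, max (z - x) 0 = ∫ x in z..1, (0 : ℝ) := by
    apply intervalIntegral.integral_congr
    intro x hx
    rw [Set.uIcc_of_le h1] at hx
    exact max_eq_right (by linarith [hx.1])
  rw [e1, e2, intervalIntegral.integral_sub (by simp) (by simp)]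
  simp
  ring

/-! ### The expected loss in a comparison of two arms -/

/-- The gap of two arms with means `x` and `z`, times the probability that the worse arm has at
least as many successes in `n` draws as the better one. -/
noncomputable def pairLoss (n : ℕ) (x z : ℝ) : ℝ :=
  if x < z then
    (z - x) * ∑ k ∈ Finset.range (n + 1), ∑ l ∈ Finset.range (n + 1),
      if k ≤ l then binomWeight n k z * binomWeight n l x else 0
  else
    (x - z) * ∑ k ∈ Finset.range (n + 1), ∑ l ∈ Finset.range (n + 1),
      if l ≤ k then binomWeight n k z * binomWeight n l x else 0

lemma pairLoss_comm (n : ℕ) (x z : ℝ) : pairLoss n x z = pairLoss n z x := by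
  unfold pairLoss
  rcases lt_trichotomy x z with h | h | h
  · rw [if_pos h, if_neg h.not_gt, Finset.sum_comm]
    simp_rw [mul_comm]
  · subst h; simp
  · rw [if_pos h, if_neg h.not_gt, Finset.sum_comm]
    simp_rw [mul_comm]

lemma pairLoss_nonneg (n : ℕ) {x z : ℝ} (hx0 : 0 ≤ x) (hx1 : x ≤ 1) (hz0 : 0 ≤ z) (hz1 : z ≤ 1) :
    0 ≤ pairLoss n x z := by
  unfold pairLoss
  split_ifs with h
  · refine mul_nonneg (by linarith) (Finset.sum_nonneg fun k _ => Finset.sum_nonneg fun l _ => ?_)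
    split_ifs
    · exact mul_nonneg (binomWeight_nonneg _ _ hz0 hz1) (binomWeight_nonneg _ _ hx0 hx1)
    · rfl
  · refine mul_nonneg (by linarith) (Finset.sum_nonneg fun k _ => Finset.sum_nonneg fun l _ => ?_)
    split_ifs
    · exact mul_nonneg (binomWeight_nonneg _ _ hz0 hz1) (binomWeight_nonneg _ _ hx0 hx1)
    · rfl

lemma measurable_pairLoss (n : ℕ) : Measurable (fun p : ℝ × ℝ => pairLoss n p.1 p.2) := by
  unfold pairLoss
  refine Measurable.ite (measurableSet_lt measurable_fst measurable_snd) ?_ ?_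
  · refine Continuous.measurable (Continuous.mul (by fun_prop) ?_)
    refine continuous_finsetSum _ fun k _ => continuous_finsetSum _ fun l _ => ?_
    split_ifs <;> fun_prop
  · refine Continuous.measurable (Continuous.mul (by fun_prop) ?_)
    refine continuous_finsetSum _ fun k _ => continuous_finsetSum _ fun l _ => ?_
    split_ifs <;> fun_prop

/-- A continuous majorant of `pairLoss`. -/
noncomputable def pairLossBound (n : ℕ) (θ x z : ℝ) : ℝ :=
  ∑ k ∈ Finset.range (n + 1), binomWeight n k z *
    (max (z - x) 0 + (x - z) * ∑ l ∈ Finset.range (k + 1), binomWeight n l x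
      + (θ + (x - z) ^ 2 / θ) / 2 * binomWeight n k x)

/-- `P(L ≥ k) = 1 - P(L ≤ k) + P(L = k)` for a binomial `L`. The last term is the probability of a
tie. -/
lemma sum_ite_le_binomWeight (n k : ℕ) (hk : k ≤ n) (x : ℝ) :
    ∑ l ∈ Finset.range (n + 1), (if k ≤ l then binomWeight n l x else 0)
      = 1 - ∑ l ∈ Finset.range (k + 1), binomWeight n l x + binomWeight n k x := by
  rw [← sum_binomWeight n x, Finset.sum_range_succ _ k]
  have h : ∑ l ∈ Finset.range k, binomWeight n l x
      = ∑ l ∈ Finset.range (n + 1), if l < k then binomWeight n l x else 0 := by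
    rw [← Finset.sum_filter]
    congr 1
    ext l; simp; omega
  rw [h, sub_add_eq_sub_sub, sub_add_cancel, eq_sub_iff_add_eq, ← Finset.sum_add_distrib]
  refine Finset.sum_congr rfl fun l _ => ?_
  by_cases hl : k ≤ l
  · simp [hl]
  · simp [hl, not_le.1 hl]

lemma sum_ite_ge_binomWeight (n k : ℕ) (hk : k ≤ n) (x : ℝ) :
    ∑ l ∈ Finset.range (n + 1), (if l ≤ k then binomWeight n l x else 0)
      = ∑ l ∈ Finset.range (k + 1), binomWeight n l x := by
  rw [← Finset.sum_filter]
  congr 1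
  ext l; simp; omega

/-- Given `k` successes of the arm with mean `z`, both cases of the loss agree with `max (z - x) 0 +
(x - z) P(L ≤ k)`, except for a tie term `(z - x) P(L = k)` when `x < z`. Replacing its coefficient
by the AM-GM bound makes everything but the maximum a polynomial in `x`, so that the integral over
`x` is explicit. -/
lemma pairLoss_le_bound (n : ℕ) {θ x z : ℝ} (hθ : 0 < θ) (hx0 : 0 ≤ x) (hx1 : x ≤ 1) (hz0 : 0 ≤ z)
    (hz1 : z ≤ 1) : pairLoss n x z ≤ pairLossBound n θ x z := by
  unfold pairLoss pairLossBound
  split_ifs with h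
  · rw [Finset.mul_sum]
    refine Finset.sum_le_sum fun k hk => ?_
    have hk : k ≤ n := by simpa [Nat.lt_succ_iff] using hk
    have e : ∑ l ∈ Finset.range (n + 1), (if k ≤ l then binomWeight n k z * binomWeight n l x else 0)
        = binomWeight n k z * ∑ l ∈ Finset.range (n + 1), (if k ≤ l then binomWeight n l x else 0) := by
      rw [Finset.mul_sum]; exact Finset.sum_congr rfl fun l _ => by split_ifs <;> simp
    rw [e, sum_ite_le_binomWeight n k hk, mul_left_comm]
    refine mul_le_mul_of_nonneg_left ?_ (binomWeight_nonneg _ _ hz0 hz1)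
    rw [max_eq_left (by linarith)]
    -- AM-GM, with the defect written as a square.
    have hq : z - x ≤ (θ + (x - z) ^ 2 / θ) / 2 := by
      rw [le_div_iff₀ two_pos, ← sub_nonneg]
      have : θ + (x - z) ^ 2 / θ - (z - x) * 2 = (θ - (z - x)) ^ 2 / θ := by field_simp; ring
      rw [this]; positivity
    have := mul_le_mul_of_nonneg_right hq (binomWeight_nonneg n k hx0 hx1)
    linarith
  · rw [Finset.mul_sum]
    refine Finset.sum_le_sum fun k hk => ?_
    have hk : k ≤ n := by simpa [Nat.lt_succ_iff] using hk
    have e : ∑ l ∈ Finset.range (n + 1), (if l ≤ k then binomWeight n k z * binomWeight n l x else 0)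
        = binomWeight n k z * ∑ l ∈ Finset.range (n + 1), (if l ≤ k then binomWeight n l x else 0) := by
      rw [Finset.mul_sum]; exact Finset.sum_congr rfl fun l _ => by split_ifs <;> simp
    rw [e, sum_ite_ge_binomWeight n k hk, mul_left_comm]
    refine mul_le_mul_of_nonneg_left ?_ (binomWeight_nonneg _ _ hz0 hz1)
    rw [max_eq_right (by linarith)]
    have := mul_nonneg (show 0 ≤ (θ + (x - z) ^ 2 / θ) / 2 by positivity)
      (binomWeight_nonneg n k hx0 hx1)
    linarith

/-- For each `k` the integral over `x` is a quadratic polynomial in `k`, so the average over `k`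
needs only the binomial moments up to order two. -/
lemma integral_pairLossBound (n : ℕ) {θ z : ℝ} (h0 : 0 ≤ z) (h1 : z ≤ 1) :
    ∫ x in (0 : ℝ)..1, pairLossBound n θ x z
      = (n * z * (1 - z) + (1 - z) ^ 2) / ((n + 1) * (n + 2))
        + (θ + ((2 * n - 6) * z * (1 - z) + 2) / ((n + 2) * (n + 3)) / θ) / (2 * (n + 1)) := by
  unfold pairLossBound
  rw [intervalIntegral.integral_finsetSum (fun k _ => by
    apply Continuous.intervalIntegrable; fun_prop)]
  have hk : ∀ k ∈ Finset.range (n + 1), ∫ x in (0 : ℝ)..1, binomWeight n k z *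
      (max (z - x) 0 + (x - z) * ∑ l ∈ Finset.range (k + 1), binomWeight n l x
        + (θ + (x - z) ^ 2 / θ) / 2 * binomWeight n k x)
      = (z ^ 2 / 2 + 2 / (2 * (n + 1) * (n + 2)) - z / (n + 1)
          + (θ + (2 / ((n + 2) * (n + 3)) - 2 * z / (n + 2) + z ^ 2) / θ) / (2 * (n + 1)))
            * binomWeight n k z
        + (3 / (2 * (n + 1) * (n + 2)) - z / (n + 1)
          + (3 / ((n + 2) * (n + 3)) - 2 * z / (n + 2)) / θ / (2 * (n + 1)))
            * (k * binomWeight n k z)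
        + (1 / (2 * (n + 1) * (n + 2)) + 1 / ((n + 2) * (n + 3)) / θ / (2 * (n + 1)))
            * (k ^ 2 * binomWeight n k z) := by
    intro k hk
    have hk : k ≤ n := by simpa [Nat.lt_succ_iff] using hk
    rw [intervalIntegral.integral_const_mul, intervalIntegral.integral_add,
      intervalIntegral.integral_add, integral_max_sub_zero h0 h1,
      integral_sub_mul_sum_binomWeight n k hk, integral_quadratic_mul_binomWeight n k hk]
    · ring
    all_goals apply Continuous.intervalIntegrable; fun_prop
  rw [Finset.sum_congr rfl hk, Finset.sum_add_distrib, Finset.sum_add_distrib, ← Finset.mul_sum,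
    ← Finset.mul_sum, ← Finset.mul_sum, sum_binomWeight, sum_mul_binomWeight,
    sum_sq_mul_binomWeight]
  rcases eq_or_ne θ 0 with rfl | hθ
  · simp
    field_simp
    ring
  · field_simp
    ring

/-- The averaged square of `x - z` in the tie term is at most `1/n`, so `θ = 1/√n` balances `θ`
against `(x - z)²/θ`. Ties then cost `O(n^(-3/2))`, which is why the rule for breaking them is
immaterial. -/
lemma integral_pairLossBound_le (n : ℕ) (hn : 1 ≤ n) {z : ℝ} (h0 : 0 ≤ z) (h1 : z ≤ 1) :
    ∫ x in (0 : ℝ)..1, pairLossBound n (1 / √n) x z ≤ (z * (1 - z) + 2 / √n) / n := by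
  rw [integral_pairLossBound n h0 h1]
  have hn' : (1 : ℝ) ≤ n := by exact_mod_cast hn
  have hs : √(n : ℝ) * √n = n := Real.mul_self_sqrt (by positivity)
  have hs1 : 1 ≤ √(n : ℝ) := by rw [Real.one_le_sqrt]; exact hn'
  have hz : 0 ≤ z * (1 - z) := mul_nonneg h0 (by linarith)
  have hz4 : z * (1 - z) ≤ 1 / 4 := by nlinarith [sq_nonneg (z - 1 / 2)]
  have a1 : (n * z * (1 - z) + (1 - z) ^ 2) / ((n + 1) * (n + 2)) ≤ (z * (1 - z) + 1 / n) / n := by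
    have : (z * (1 - z) + 1 / (n : ℝ)) / n = (n * (z * (1 - z)) + 1) / (n * n) := by field_simp
    rw [this]
    apply div_le_div₀ <;> nlinarith
  have a2 : ((2 * n - 6) * z * (1 - z) + 2) / (((n : ℝ) + 2) * (n + 3)) ≤ 1 / n := by
    rw [div_le_div_iff₀ (by positivity) (by positivity)]
    have : (2 * n - 6) * z * (1 - z) ≤ (n : ℝ) / 2 := by nlinarith
    nlinarith
  have a3 : ((2 * n - 6) * z * (1 - z) + 2) / (((n : ℝ) + 2) * (n + 3)) / (1 / √n) ≤ 1 / √n := by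
    rw [div_div_eq_mul_div, div_one]
    calc _ ≤ 1 / (n : ℝ) * √n := mul_le_mul_of_nonneg_right a2 (by positivity)
      _ = 1 / √n := by
        rw [div_mul_eq_mul_div, one_mul, div_eq_div_iff (by positivity) (by positivity), hs, one_mul]
  have a4 : (1 / √n + ((2 * n - 6) * z * (1 - z) + 2) / (((n : ℝ) + 2) * (n + 3)) / (1 / √n))
      / (2 * (n + 1)) ≤ 1 / √n / n := by
    have : 1 / √(n : ℝ) / n = (2 * (1 / √n)) / (2 * n) := by field_simp
    rw [this]
    apply div_le_div₀ (by positivity) (by linarith) (by positivity) (by linarith)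
  have a5 : 1 / (n : ℝ) ≤ 1 / √n := by
    apply one_div_le_one_div_of_le (by positivity)
    nlinarith
  calc _ ≤ (z * (1 - z) + 1 / n) / n + 1 / √n / n := add_le_add a1 a4
    _ ≤ (z * (1 - z) + 1 / √n) / n + 1 / √n / n := by gcongr
    _ = _ := by ring

lemma lintegral_unitInterval_eq {f : ℝ → ℝ} (hf : Continuous f) (h0 : ∀ x : I, 0 ≤ f x) :
    ∫⁻ x : I, ENNReal.ofReal (f x) = ENNReal.ofReal (∫ x in (0 : ℝ)..1, f x) := by
  have hc : Continuous fun x : I => f x := hf.comp continuous_subtype_val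
  have hint : Integrable (fun x : I => f x) volume := by
    rw [← integrableOn_univ]
    exact hc.continuousOn.integrableOn_compact isCompact_univ
  rw [← ofReal_integral_eq_lintegral_ofReal hint (ae_of_all _ h0),
    intervalIntegral.integral_of_le zero_le_one, ← integral_Icc_eq_integral_Ioc,
    ← unitInterval.measurePreserving_coe.map_eq,
    unitInterval.measurableEmbedding_coe.integral_map]

/-- For a uniformly distributed mean of one arm, the expected loss in the comparison of two arms
after `n` draws is at most the variance of the other arm divided by `n`, up to lower order terms. -/
lemma lintegral_pairLoss_le (n : ℕ) (hn : 1 ≤ n) (z : I) :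
    ∫⁻ x : I, ENNReal.ofReal (pairLoss n x z)
      ≤ ENNReal.ofReal (((z : ℝ) * (1 - z) + 2 / √n) / n) := by
  have hθ : (0 : ℝ) < 1 / √n := by
    have : (0 : ℝ) < n := by exact_mod_cast hn
    positivity
  have hle : ∀ x : I, pairLoss n x z ≤ pairLossBound n (1 / √n) x z := fun x =>
    pairLoss_le_bound n hθ x.2.1 x.2.2 z.2.1 z.2.2
  calc _ ≤ ∫⁻ x : I, ENNReal.ofReal (pairLossBound n (1 / √n) x z) :=
        lintegral_mono fun x => ENNReal.ofReal_le_ofReal (hle x)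
    _ = ENNReal.ofReal (∫ x in (0 : ℝ)..1, pairLossBound n (1 / √n) x z) :=
        lintegral_unitInterval_eq (f := fun x => pairLossBound n (1 / √n) x z)
          (by unfold pairLossBound; fun_prop)
          fun x => (pairLoss_nonneg n x.2.1 x.2.2 z.2.1 z.2.2).trans (hle x)
    _ ≤ _ := ENNReal.ofReal_le_ofReal (integral_pairLossBound_le n hn z.2.1 z.2.2)

/-! ### The law of the rewards -/

instance {K T : ℕ} (μ : Fin K → I) : IsProbabilityMeasure (rewardLaw T μ) := by
  unfold rewardLaw; infer_instance

/-- The law of finitely many independent Bernoulli variables with the same mean. -/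
noncomputable def bernoulliPi (ι : Type*) [Fintype ι] (x : I) : Measure (ι → Bool) :=
  Measure.pi fun _ => bernoulliMeasure true false x

instance (ι : Type*) [Fintype ι] (x : I) : IsProbabilityMeasure (bernoulliPi ι x) := by
  unfold bernoulliPi; infer_instance

lemma bernoulliMeasure_bool_real (x : I) (b : Bool) :
    (bernoulliMeasure true false x).real {b} = if b then (x : ℝ) else 1 - x := by
  cases b
  · rw [bernoulliMeasure_real_apply_of_notMem_of_mem] <;> simp
  · rw [bernoulliMeasure_real_apply_of_mem_of_notMem] <;> simp

lemma bernoulliPi_real_agree {ι : Type*} [Fintype ι] [DecidableEq ι] (x : I) {A B : Finset ι}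
    (hB : B ⊆ A) :
    (bernoulliPi ι x).real {ω | A.filter (fun s => ω s = true) = B}
      = (x : ℝ) ^ B.card * (1 - x) ^ (A.card - B.card) := by
  -- The event is a cylinder: coordinates in `A` are prescribed, the others are free.
  have hset : {ω : ι → Bool | A.filter (fun s => ω s = true) = B}
      = Set.univ.pi fun s => if s ∈ A then {decide (s ∈ B)} else Set.univ := by
    ext ω
    simp only [Set.mem_ofPred_eq, Set.mem_univ_pi, Finset.ext_iff, Finset.mem_filter]
    refine forall_congr' fun s => ?_
    by_cases hA : s ∈ A
    · by_cases hs : s ∈ B <;> simp [hA, hs]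
    · have : s ∉ B := fun h => hA (hB h)
      simp [hA, this]
  rw [hset, bernoulliPi, measureReal_def, Measure.pi_pi, ENNReal.toReal_prod]
  have hf : ∀ s : ι, (bernoulliMeasure true false x
      (if s ∈ A then {decide (s ∈ B)} else Set.univ)).toReal
      = if s ∈ A then (if s ∈ B then (x : ℝ) else 1 - x) else 1 := by
    intro s
    by_cases hA : s ∈ A
    · simp only [hA, if_true]
      rw [← measureReal_def, bernoulliMeasure_bool_real]
      simp
    · simp [hA]
  rw [Finset.prod_congr rfl fun s _ => hf s, Finset.prod_ite_mem, Finset.univ_inter,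
    Finset.prod_ite, Finset.prod_const, Finset.prod_const, Finset.filter_mem_eq_inter,
    Finset.inter_eq_right.2 hB, Finset.filter_notMem_eq_sdiff, Finset.card_sdiff_of_subset hB]

lemma bernoulliPi_real_card {ι : Type*} [Fintype ι] (x : I) (A : Finset ι) (k : ℕ) :
    (bernoulliPi ι x).real {ω | (A.filter (fun s => ω s = true)).card = k}
      = binomWeight A.card k x := by
  classical
  have hset : {ω : ι → Bool | (A.filter (fun s => ω s = true)).card = k}
      = ⋃ B ∈ A.powersetCard k, {ω | A.filter (fun s => ω s = true) = B} := by
    ext ω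
    simp only [Set.mem_ofPred_eq, Set.mem_iUnion, Finset.mem_powersetCard, exists_prop]
    constructor
    · intro h; exact ⟨_, ⟨Finset.filter_subset _ _, h⟩, rfl⟩
    · rintro ⟨B, ⟨-, h⟩, rfl⟩; exact h
  rw [hset, measureReal_biUnion_finset]
  · rw [Finset.sum_congr rfl (g := fun _ => (x : ℝ) ^ k * (1 - x) ^ (A.card - k))]
    · rw [Finset.sum_const, Finset.card_powersetCard, nsmul_eq_mul, binomWeight, mul_assoc]
    · intro B hB
      obtain ⟨h1, h2⟩ := Finset.mem_powersetCard.1 hB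
      rw [bernoulliPi_real_agree x h1, h2]
  · intro B _ C _ hBC
    refine Set.disjoint_left.2 fun ω h1 h2 => hBC ?_
    exact h1.symm.trans h2
  · intro B _; exact MeasurableSet.of_discrete

/-! ### Success counts of one arm and of two arms -/

/-- The number of successes among the first `n` draws of arm `i`. -/
def successes {K T : ℕ} (ω : Rewards K T) (i : Fin K) (n : ℕ) : ℕ :=
  (Finset.univ.filter fun s : Fin T => (s : ℕ) < n ∧ ω i s = true).card

lemma empMean_eq {K T : ℕ} (ω : Rewards K T) (i : Fin K) (n : ℕ) :
    empMean ω i n = (successes ω i n : ℝ) / n := rfl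

/-- The first `n` draws. -/
def firstIndices (T n : ℕ) : Finset (Fin T) := Finset.univ.filter fun s => (s : ℕ) < n

lemma card_firstIndices {T n : ℕ} (h : n ≤ T) : (firstIndices T n).card = n := by
  rw [firstIndices, Fin.card_filter_val_lt]
  exact min_eq_right h

lemma successes_eq {K T : ℕ} (ω : Rewards K T) (i : Fin K) (n : ℕ) :
    successes ω i n = ((firstIndices T n).filter fun s => ω i s = true).card := by
  rw [successes, firstIndices, Finset.filter_filter]

lemma rewardLaw_real_eval {K T : ℕ} (μ : Fin K → I) (i : Fin K) (S : Set (Fin T → Bool)) :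
    (rewardLaw T μ).real {ω | ω i ∈ S} = (bernoulliPi (Fin T) (μ i)).real S := by
  have h := measurePreserving_eval
    (fun i => (Measure.pi fun _ : Fin T => bernoulliMeasure true false (μ i))) i
  exact h.measureReal_preimage MeasurableSet.of_discrete.nullMeasurableSet

lemma rewardLaw_real_successes {K T : ℕ} (μ : Fin K → I) (i : Fin K) {n : ℕ} (hn : n ≤ T) (k : ℕ) :
    (rewardLaw T μ).real {ω | successes ω i n = k} = binomWeight n k (μ i) := by
  simp_rw [successes_eq]
  have h := rewardLaw_real_eval μ i
    {x : Fin T → Bool | ((firstIndices T n).filter fun s => x s = true).card = k}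
  rw [bernoulliPi_real_card, card_firstIndices hn] at h
  exact h

lemma rewardLaw_real_successes_two {K T : ℕ} (μ : Fin K → I) {i j : Fin K} (hij : i ≠ j) {n : ℕ}
    (hn : n ≤ T) (k l : ℕ) :
    (rewardLaw T μ).real {ω | successes ω i n = k ∧ successes ω j n = l}
      = binomWeight n k (μ i) * binomWeight n l (μ j) := by
  have hind : IndepFun (fun ω : Rewards K T => ω i) (fun ω => ω j) (rewardLaw T μ) :=
    (iIndepFun_pi (μ := fun i => (Measure.pi fun _ : Fin T => bernoulliMeasure true false (μ i)))
      (X := fun _ x => x) (fun _ => aemeasurable_id)).indepFun hij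
  have h := hind.measure_inter_preimage_eq_mul
    {x : Fin T → Bool | ((firstIndices T n).filter fun s => x s = true).card = k}
    {x : Fin T → Bool | ((firstIndices T n).filter fun s => x s = true).card = l}
    MeasurableSet.of_discrete MeasurableSet.of_discrete
  rw [← rewardLaw_real_successes μ i hn, ← rewardLaw_real_successes μ j hn, measureReal_def,
    measureReal_def, measureReal_def, ← ENNReal.toReal_mul]
  simp_rw [successes_eq]
  exact congrArg ENNReal.toReal h

lemma successes_le {K T : ℕ} (ω : Rewards K T) (i : Fin K) {n : ℕ} (hn : n ≤ T) :
    successes ω i n ≤ n := by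
  rw [successes_eq]
  exact (Finset.card_filter_le _ _).trans (card_firstIndices hn).le

/-- The expected loss in a comparison of two arms after `n` draws of each. -/
lemma gap_mul_rewardLaw_real {K T : ℕ} (μ : Fin K → I) {i j : Fin K} (hij : i ≠ j) {n : ℕ}
    (hn : n ≤ T) (hμ : μ i ≤ μ j) :
    ((μ j : ℝ) - μ i) * (rewardLaw T μ).real {ω | successes ω j n ≤ successes ω i n}
      = pairLoss n (μ i) (μ j) := by
  have hset : {ω : Rewards K T | successes ω j n ≤ successes ω i n}
      = ⋃ p ∈ (Finset.range (n + 1) ×ˢ Finset.range (n + 1)).filter (fun p => p.1 ≤ p.2),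
          {ω | successes ω j n = p.1 ∧ successes ω i n = p.2} := by
    ext ω
    simp only [Set.mem_ofPred_eq, Set.mem_iUnion, exists_prop, Finset.mem_filter,
      Finset.mem_product, Finset.mem_range]
    constructor
    · intro h
      have h1 := successes_le ω i hn
      have h2 := successes_le ω j hn
      exact ⟨(successes ω j n, successes ω i n), ⟨⟨by simpa [Nat.lt_succ_iff], by simpa [Nat.lt_succ_iff]⟩, h⟩, rfl, rfl⟩
    · rintro ⟨p, ⟨-, hp⟩, h1, h2⟩; rwa [h1, h2]
  have hP : (rewardLaw T μ).real {ω | successes ω j n ≤ successes ω i n}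
      = ∑ k ∈ Finset.range (n + 1), ∑ l ∈ Finset.range (n + 1),
        if k ≤ l then binomWeight n k (μ j) * binomWeight n l (μ i) else 0 := by
    rw [hset, measureReal_biUnion_finset, Finset.sum_filter, Finset.sum_product]
    · refine Finset.sum_congr rfl fun k _ => Finset.sum_congr rfl fun l _ => ?_
      simp only [rewardLaw_real_successes_two μ hij.symm hn]
    · intro p _ p' _ hpp
      refine Set.disjoint_left.2 fun ω h1 h2 => hpp ?_
      exact Prod.ext (h1.1.symm.trans h2.1) (h1.2.symm.trans h2.2)
    · intro p _; exact MeasurableSet.of_discrete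
  rw [hP, pairLoss]
  rcases hμ.lt_or_eq with h | h
  · rw [if_pos (by exact_mod_cast h)]
  -- For equal means the gap annihilates both sides, whichever branch of `pairLoss` applies.
  · simp [h]

/-! ### Hoeffding's inequality -/

lemma hasSubgaussianMGF_bernoulliPi {ι : Type*} [Fintype ι] (x : I) (s : ι) :
    HasSubgaussianMGF (fun ω : ι → Bool => (if ω s = true then (1 : ℝ) else 0) - x) (1 / 4)
      (bernoulliPi ι x) := by
  have hint : ∫ ω, (if ω s = true then (1 : ℝ) else 0) ∂(bernoulliPi ι x) = x := by
    have h := (measurePreserving_eval (fun _ : ι => bernoulliMeasure true false x) s)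
    have h2 : ∫ ω, (fun b : Bool => if b = true then (1 : ℝ) else 0) (Function.eval s ω)
        ∂(bernoulliPi ι x) = ∫ b, (if b = true then (1 : ℝ) else 0) ∂(bernoulliMeasure true false x) := by
      rw [← h.map_eq, integral_map h.measurable.aemeasurable]
      · rfl
      · exact (Measurable.of_discrete).aestronglyMeasurable
    refine h2.trans ?_
    rw [integral_fintype (Integrable.of_finite)]
    simp [bernoulliMeasure_bool_real]
  have h := hasSubgaussianMGF_of_mem_Icc (μ := bernoulliPi ι x) (a := 0) (b := 1)
    (X := fun ω : ι → Bool => if ω s = true then (1 : ℝ) else 0)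
    (Measurable.of_discrete).aemeasurable (ae_of_all _ fun ω => by
      show (if ω s = true then (1 : ℝ) else 0) ∈ _
      split_ifs <;> simp)
  rw [hint] at h
  convert h using 1
  ext; norm_num

lemma iIndepFun_bernoulliPi {ι : Type*} [Fintype ι] (x : I) :
    iIndepFun (fun (s : ι) (ω : ι → Bool) => (if ω s = true then (1 : ℝ) else 0) - x)
      (bernoulliPi ι x) :=
  iIndepFun_pi (μ := fun _ : ι => bernoulliMeasure true false x)
    (X := fun _ b => (if b = true then (1 : ℝ) else 0) - x)
    (fun _ => (Measurable.of_discrete).aemeasurable)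

lemma sum_indicator_sub {ι : Type*} (x : ℝ) (A : Finset ι) (ω : ι → Bool) :
    ∑ s ∈ A, ((if ω s = true then (1 : ℝ) else 0) - x)
      = ((A.filter fun s => ω s = true).card : ℝ) - A.card * x := by
  rw [Finset.sum_sub_distrib, Finset.sum_boole]
  simp

lemma bernoulliPi_real_deviation_le {ι : Type*} [Fintype ι] (x : I) (A : Finset ι) {ε : ℝ}
    (hε : 0 ≤ ε) :
    (bernoulliPi ι x).real {ω | ε ≤ |((A.filter fun s => ω s = true).card : ℝ) - A.card * x|}
      ≤ 2 * Real.exp (-2 * ε ^ 2 / A.card) := by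
  have hsub : {ω : ι → Bool | ε ≤ |((A.filter fun s => ω s = true).card : ℝ) - A.card * x|}
      ⊆ {ω | ε ≤ ∑ s ∈ A, ((if ω s = true then (1 : ℝ) else 0) - x)}
        ∪ {ω | ε ≤ ∑ s ∈ A, -((if ω s = true then (1 : ℝ) else 0) - x)} := by
    intro ω hω
    simp only [Set.mem_ofPred_eq, le_abs] at hω
    simp only [Set.mem_union, Set.mem_ofPred_eq, Finset.sum_neg_distrib, sum_indicator_sub]
    exact hω
  have hexp : -ε ^ 2 / (2 * ((∑ _s ∈ A, (1 / 4 : NNReal) : NNReal) : ℝ)) = -2 * ε ^ 2 / A.card := by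
    simp only [Finset.sum_const, nsmul_eq_mul]
    push_cast
    rcases eq_or_ne (A.card : ℝ) 0 with h | h
    · simp [h]
    · field_simp
      norm_num
  have h1 := HasSubgaussianMGF.measure_sum_ge_le_of_iIndepFun (iIndepFun_bernoulliPi x) (s := A)
    (c := fun _ => 1 / 4) (fun s _ => hasSubgaussianMGF_bernoulliPi x s) hε
  have hneg : iIndepFun (fun (s : ι) (ω : ι → Bool) => -((if ω s = true then (1 : ℝ) else 0) - x))
      (bernoulliPi ι x) :=
    (iIndepFun_bernoulliPi x).comp (fun _ y => -y) (fun _ => measurable_neg)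
  have h2 := HasSubgaussianMGF.measure_sum_ge_le_of_iIndepFun hneg (s := A)
    (c := fun _ => 1 / 4) (fun s _ => (hasSubgaussianMGF_bernoulliPi x s).neg) hε
  push_cast at hexp h1 h2
  rw [hexp] at h1 h2
  calc _ ≤ _ := measureReal_mono hsub
    _ ≤ _ := measureReal_union_le _ _
    _ ≤ _ := add_le_add h1 h2
    _ = _ := by ring

/-- Hoeffding's inequality for the empirical means. -/
lemma rewardLaw_real_empMean_deviation_le {K T : ℕ} (μ : Fin K → I) (i : Fin K) {n : ℕ}
    (hn : n ≤ T) (hn0 : 0 < n) {B : ℝ} (hB : 0 ≤ B) :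
    (rewardLaw T μ).real {ω | B ≤ |empMean ω i n - μ i|} ≤ 2 * Real.exp (-2 * n * B ^ 2) := by
  have hn' : (0 : ℝ) < n := by exact_mod_cast hn0
  have h := bernoulliPi_real_deviation_le (μ i) (firstIndices T n) (ε := n * B) (by positivity)
  rw [card_firstIndices hn, ← rewardLaw_real_eval μ i] at h
  convert h using 3
  · ext ω
    simp only [Set.mem_ofPred_eq, empMean_eq, ← successes_eq]
    rw [show (successes ω i n : ℝ) - n * μ i = n * ((successes ω i n : ℝ) / n - μ i) by field_simp,
      abs_mul, abs_of_pos hn', mul_le_mul_iff_right₀ hn']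
  · field_simp

lemma rewardLaw_real_singleton {K T : ℕ} (μ : Fin K → I) (ω : Rewards K T) :
    (rewardLaw T μ).real {ω}
      = ∏ i, ∏ s, if ω i s then (μ i : ℝ) else 1 - μ i := by
  rw [rewardLaw, measureReal_def, Measure.pi_singleton, ENNReal.toReal_prod]
  refine Finset.prod_congr rfl fun i _ => ?_
  rw [Measure.pi_singleton, ENNReal.toReal_prod]
  refine Finset.prod_congr rfl fun s _ => ?_
  rw [← measureReal_def, bernoulliMeasure_bool_real]

/-! ### Elementary properties of the regret -/

lemma measurable_best {ι : Type*} [Fintype ι] : Measurable (best : (ι → I) → I) :=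
  (Continuous.finset_sup_apply fun i _ => continuous_apply i).measurable

lemma le_best {ι : Type*} [Fintype ι] (μ : ι → I) (i : ι) : μ i ≤ best μ :=
  Finset.le_sup (f := μ) (Finset.mem_univ i)

lemma exists_eq_best {ι : Type*} [Fintype ι] [Nonempty ι] (μ : ι → I) : ∃ i, best μ = μ i := by
  obtain ⟨i, -, hi⟩ := Finset.exists_mem_eq_sup Finset.univ Finset.univ_nonempty μ
  exact ⟨i, hi⟩

lemma regret_eq_integral {K T : ℕ} (J : Rewards K T → Fin K) (μ : Fin K → I) :
    regret J μ = ∫ ω, ((best μ : ℝ) - μ (J ω)) ∂(rewardLaw T μ) := by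
  rw [integral_sub (integrable_const _) Integrable.of_finite]
  simp [regret]

lemma regret_nonneg {K T : ℕ} (J : Rewards K T → Fin K) (μ : Fin K → I) : 0 ≤ regret J μ := by
  rw [regret_eq_integral]
  exact integral_nonneg fun ω => sub_nonneg.2 (le_best μ (J ω))

lemma regret_le_one {K T : ℕ} (J : Rewards K T → Fin K) (μ : Fin K → I) : regret J μ ≤ 1 := by
  have h : 0 ≤ ∫ ω, (μ (J ω) : ℝ) ∂(rewardLaw T μ) := integral_nonneg fun ω => (μ (J ω)).2.1
  have := (best μ).2.2
  unfold regret; linarith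

/-- The reward space is finite, so the inner expectation is a polynomial in the parameters. -/
lemma measurable_regret {K T : ℕ} (J : Rewards K T → Fin K) : Measurable (regret J) := by
  have hc : ∀ i, Measurable fun μ : Fin K → I => (μ i : ℝ) := fun i =>
    measurable_subtype_coe.comp (measurable_pi_apply i)
  unfold regret
  simp_rw [integral_fintype (μ := rewardLaw T _) Integrable.of_finite, rewardLaw_real_singleton]
  refine (measurable_subtype_coe.comp measurable_best).sub (Finset.measurable_fun_sum _ fun ω _ => ?_)
  simp only [smul_eq_mul]
  have hp : ∀ (i : Fin K) (c : Bool), Measurable fun μ : Fin K → I =>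
      if c then (μ i : ℝ) else 1 - μ i := by
    intro i c
    cases c
    · simpa using (hc i).const_sub 1
    · simpa using hc i
  exact (Finset.measurable_fun_prod _ fun i _ =>
    Finset.measurable_fun_prod _ fun s _ => hp i (ω i s)).mul (hc (J ω))

lemma integrable_regret {K T : ℕ} (J : Rewards K T → Fin K) (H : Measure (Fin K → I))
    [IsProbabilityMeasure H] : Integrable (regret J) H :=
  Integrable.of_mem_Icc 0 1 (measurable_regret J).aemeasurable
    (ae_of_all _ fun μ => ⟨regret_nonneg J μ, regret_le_one J μ⟩)

/-! ### The regret for given parameters -/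

/-- The number of draws of each of two candidates in both stages. -/
noncomputable def pairDraws (K : ℕ) (q : ℝ) (T : ℕ) : ℕ := firstDraws K q T + secondDraws q T 2

/-- The parameters for which two arms have means within `r` of that of a third one. -/
def closeTriples (K : ℕ) (r : ℝ) : Set (Fin K → I) :=
  {μ | ∃ i j k, i ≠ j ∧ i ≠ k ∧ j ≠ k ∧ |(μ i : ℝ) - μ k| ≤ r ∧ |(μ j : ℝ) - μ k| ≤ r}

/-- The event that some confidence interval of the first stage fails. -/
def badEvent {K : ℕ} (q : ℝ) (T : ℕ) (μ : Fin K → I) : Set (Rewards K T) :=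
  {ω | ∃ i, confWidth K q T ≤ |empMean ω i (firstDraws K q T) - μ i|}

variable {K T : ℕ} {q : ℝ}

lemma mem_candidates {ω : Rewards K T} {i : Fin K} :
    i ∈ candidates q ω ↔ ∀ j, empMean ω j (firstDraws K q T) - confWidth K q T
      ≤ empMean ω i (firstDraws K q T) + confWidth K q T := by
  unfold candidates
  rw [Finset.mem_filter]
  exact and_iff_right (Finset.mem_univ i)

/-- Two widths come from the candidate criterion and two from the errors of the two empirical means.
-/
lemma gap_le_of_mem_candidates {μ : Fin K → I} {ω : Rewards K T} (hω : ω ∉ badEvent q T μ)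
    {i : Fin K} (hi : i ∈ candidates q ω) (b : Fin K) :
    (μ b : ℝ) - μ i ≤ 4 * confWidth K q T := by
  simp only [badEvent, Set.mem_ofPred_eq, not_exists, not_le, abs_lt] at hω
  linarith [hω b, hω i, mem_candidates.1 hi b]

lemma mem_candidates_of_forall_le {μ : Fin K → I} {ω : Rewards K T} (hω : ω ∉ badEvent q T μ)
    {b : Fin K} (hb : ∀ i, μ i ≤ μ b) : b ∈ candidates q ω := by
  simp only [badEvent, Set.mem_ofPred_eq, not_exists, not_le, abs_lt] at hω
  refine mem_candidates.2 fun j => ?_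
  have : (μ j : ℝ) ≤ μ b := hb j
  linarith [hω b, hω j]

/-- If no three arms are close, a suboptimal recommendation outside of the bad event is the second
best arm, which is close to the best one and at least as successful. -/
lemma recommendation_cases {μ : Fin K → I} {J : Rewards K T → Fin K} (hJ : IsRecommendation q J)
    {ω : Rewards K T} (hω : ω ∉ badEvent q T μ) (hμ : μ ∉ closeTriples K (4 * confWidth K q T))
    (hn : 0 < pairDraws K q T) {a b : Fin K} (hab : a ≠ b) (hb : ∀ i, μ i ≤ μ b)
    (ha : ∀ i, i ≠ b → μ i ≤ μ a) :
    J ω = b ∨ (J ω = a ∧ (μ b : ℝ) - μ a ≤ 4 * confWidth K q T ∧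
      successes ω b (pairDraws K q T) ≤ successes ω a (pairDraws K q T)) := by
  -- A third candidate `c` would be within four widths of `b`; so would `a`, whose mean lies between
  -- theirs, making `c`, `a`, `b` a close triple.
  have hc : ∀ c ∈ candidates q ω, c = a ∨ c = b := by
    intro c hc
    by_contra! h
    have h1 := gap_le_of_mem_candidates hω hc b
    have h2 : (μ c : ℝ) ≤ μ a := ha c h.2
    have h3 : (μ a : ℝ) ≤ μ b := hb a
    refine hμ ⟨c, a, b, h.1, h.2, hab, ?_, ?_⟩ <;> rw [abs_le] <;> constructor <;> linarith
  rcases hc _ (hJ ω).1 with h | h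
  · right
    have hac : a ∈ candidates q ω := h ▸ (hJ ω).1
    have hbc := mem_candidates_of_forall_le hω hb
    have hcard : (candidates q ω).card = 2 := by
      have : candidates q ω = {a, b} := by
        ext c
        constructor
        · intro h; simpa using hc c h
        · intro h
          rcases Finset.mem_insert.1 h with h | h
          · rwa [h]
          · rwa [Finset.mem_singleton.1 h]
      rw [this, Finset.card_pair hab]
    -- With exactly two candidates both final means have the denominator `pairDraws`, so comparing
    -- them compares success counts.
    have hf := (hJ ω).2 (by omega) b hbc
    rw [finalMean, finalMean, hcard, h, empMean_eq, empMean_eq] at hf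
    refine ⟨h, gap_le_of_mem_candidates hω hac b, ?_⟩
    have hn' : (0 : ℝ) < pairDraws K q T := by exact_mod_cast hn
    have := (div_le_div_iff_of_pos_right hn').1 hf
    exact_mod_cast this
  · exact Or.inl h

/-- The loss that is due to the comparison of an arm with the best of the others. -/
noncomputable def localLoss (n : ℕ) (r : ℝ) (x z : ℝ) : ℝ := if |x - z| ≤ r then pairLoss n x z else 0

lemma localLoss_nonneg (n : ℕ) (r : ℝ) (x z : I) : 0 ≤ localLoss n r x z := by
  unfold localLoss
  split_ifs
  · exact pairLoss_nonneg n x.2.1 x.2.2 z.2.1 z.2.2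
  · rfl

lemma measurable_localLoss (n : ℕ) (r : ℝ) : Measurable fun p : ℝ × ℝ => localLoss n r p.1 p.2 :=
  Measurable.ite (measurableSet_le (by fun_prop) measurable_const) (measurable_pairLoss n)
    measurable_const

lemma localLoss_comm (n : ℕ) (r : ℝ) (x z : ℝ) : localLoss n r x z = localLoss n r z x := by
  rw [localLoss, localLoss, abs_sub_comm, pairLoss_comm]

/-- The two best arms are each the best competitor of the other. The summands of arms `a` and `b` in
`regret_le` therefore describe the same comparison. -/
lemma exists_best_two (hK : 2 ≤ K) (μ : Fin K → I) :
    ∃ a b : Fin K, a ≠ b ∧ best μ = μ b ∧ best (except b μ) = μ a ∧ best (except a μ) = μ b := by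
  have : Nontrivial (Fin K) := Fin.nontrivial_iff_two_le.2 hK
  obtain ⟨b, hb⟩ := exists_eq_best μ
  have : Nonempty {j : Fin K // j ≠ b} := 
    let ⟨j, hj⟩ := exists_ne b; ⟨⟨j, hj⟩⟩
  obtain ⟨⟨a, hab⟩, ha⟩ := exists_eq_best (except b μ)
  refine ⟨a, b, hab, hb, ha, le_antisymm ?_ ?_⟩
  · exact Finset.sup_le fun j _ => hb ▸ le_best μ j
  · exact le_best (except a μ) ⟨b, hab.symm⟩

/-- The regret for given parameters is at most the sum of the contributions of the bad event, of the
parameters with three close arms, and of the comparisons of two arms. -/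
lemma regret_le (hK : 2 ≤ K) {J : Rewards K T → Fin K} (hJ : IsRecommendation q J)
    (hn0 : 0 < pairDraws K q T) (hnT : pairDraws K q T ≤ T) (μ : Fin K → I) :
    regret J μ ≤ (rewardLaw T μ).real (badEvent q T μ)
      + (closeTriples K (4 * confWidth K q T)).indicator (fun _ => 4 * confWidth K q T) μ
      + 1 / 2 * ∑ i, localLoss (pairDraws K q T) (4 * confWidth K q T) (μ i)
        (best (except i μ)) := by
  set n := pairDraws K q T
  set r := 4 * confWidth K q T
  have hr : 0 ≤ r := mul_nonneg (by norm_num) (Real.sqrt_nonneg _)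
  have hle1 : ∀ ω, (best μ : ℝ) - μ (J ω) ≤ 1 := fun ω => by
    linarith [(best μ).2.2, (μ (J ω)).2.1]
  have hsum0 : 0 ≤ ∑ i, localLoss n r (μ i) (best (except i μ)) :=
    Finset.sum_nonneg fun i _ => localLoss_nonneg n r (μ i) (best (except i μ))
  have hbad : ∫ ω, (badEvent q T μ).indicator (fun _ => (1 : ℝ)) ω ∂(rewardLaw T μ)
      = (rewardLaw T μ).real (badEvent q T μ) := by
    rw [integral_indicator MeasurableSet.of_discrete]; simp
  obtain ⟨a, b, hab, hb, ha, hba⟩ := exists_best_two hK μ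
  have hbmax : ∀ i, μ i ≤ μ b := fun i => hb ▸ le_best μ i
  rw [regret_eq_integral]
  by_cases hμ : μ ∈ closeTriples K r
  · rw [Set.indicator_of_mem hμ]
    have h : ∫ ω, ((best μ : ℝ) - μ (J ω)) ∂(rewardLaw T μ)
        ≤ ∫ ω, ((badEvent q T μ).indicator (fun _ => (1 : ℝ)) ω + r) ∂(rewardLaw T μ) := by
      refine integral_mono Integrable.of_finite Integrable.of_finite fun ω => ?_
      show (best μ : ℝ) - μ (J ω) ≤ (badEvent q T μ).indicator (fun _ => (1 : ℝ)) ω + r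
      by_cases hω : ω ∈ badEvent q T μ
      · rw [Set.indicator_of_mem hω]; linarith [hle1 ω]
      · rw [Set.indicator_of_notMem hω, hb]
        linarith [gap_le_of_mem_candidates hω (hJ ω).1 b]
    rw [integral_add Integrable.of_finite Integrable.of_finite, hbad] at h
    simp only [integral_const, probReal_univ, one_smul] at h
    linarith
  · rw [Set.indicator_of_notMem hμ, add_zero]
    have h : ∫ ω, ((best μ : ℝ) - μ (J ω)) ∂(rewardLaw T μ)
        ≤ ∫ ω, ((badEvent q T μ).indicator (fun _ => (1 : ℝ)) ω
          + if (μ b : ℝ) - μ a ≤ r then ((μ b : ℝ) - μ a) *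
            {ω | successes ω b n ≤ successes ω a n}.indicator (fun _ => (1 : ℝ)) ω else 0)
              ∂(rewardLaw T μ) := by
      refine integral_mono Integrable.of_finite Integrable.of_finite fun ω => ?_
      have hgap : 0 ≤ (μ b : ℝ) - μ a := sub_nonneg.2 (hbmax a)
      have hnn : 0 ≤ if (μ b : ℝ) - μ a ≤ r then ((μ b : ℝ) - μ a) *
          {ω | successes ω b n ≤ successes ω a n}.indicator (fun _ => (1 : ℝ)) ω else 0 := by
        split_ifs
        · exact mul_nonneg hgap (Set.indicator_nonneg (fun _ _ => zero_le_one) ω)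
        · rfl
      show (best μ : ℝ) - μ (J ω) ≤ (badEvent q T μ).indicator (fun _ => (1 : ℝ)) ω + _
      by_cases hω : ω ∈ badEvent q T μ
      · rw [Set.indicator_of_mem hω]; linarith [hle1 ω]
      · rw [Set.indicator_of_notMem hω, zero_add, hb]
        rcases recommendation_cases hJ hω hμ hn0 hab hbmax
          (fun i hi => ha ▸ le_best (except b μ) ⟨i, hi⟩) with h | ⟨h, h1, h2⟩
        · rw [h, sub_self]; exact hnn
        · rw [if_pos h1, Set.indicator_of_mem (by exact h2), h, mul_one]
    rw [integral_add Integrable.of_finite Integrable.of_finite, hbad] at h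
    have hpair : ∫ ω, (if (μ b : ℝ) - μ a ≤ r then ((μ b : ℝ) - μ a) *
            {ω | successes ω b n ≤ successes ω a n}.indicator (fun _ => (1 : ℝ)) ω else 0)
              ∂(rewardLaw T μ) = localLoss n r (μ a) (μ b) := by
      have habs : |(μ a : ℝ) - μ b| = μ b - μ a := by
        have : (μ a : ℝ) ≤ μ b := hbmax a
        rw [abs_sub_comm, abs_of_nonneg (sub_nonneg.2 this)]
      rw [localLoss, habs]
      split_ifs
      · rw [integral_const_mul, integral_indicator MeasurableSet.of_discrete,
          ← gap_mul_rewardLaw_real μ hab hnT (hbmax a)]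
        simp
      · simp
    rw [hpair] at h
    -- By symmetry of `localLoss` the terms of `a` and `b` coincide; all the others are non-negative
    -- and are dropped.
    have hs : 2 * localLoss n r (μ a) (μ b)
        ≤ ∑ i, localLoss n r (μ i) (best (except i μ)) := by
      calc 2 * localLoss n r (μ a) (μ b)
          = ∑ i ∈ {a, b}, localLoss n r (μ i) (best (except i μ)) := by
            rw [Finset.sum_pair hab, ha, hba, localLoss_comm n r (μ b)]; ring
        _ ≤ _ := Finset.sum_le_sum_of_subset_of_nonneg (Finset.subset_univ _)
            fun i _ _ => localLoss_nonneg n r (μ i) (best (except i μ))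
    linarith

lemma rewardLaw_real_badEvent_le (μ : Fin K → I) (h0 : 0 < firstDraws K q T)
    (hT : firstDraws K q T ≤ T) :
    (rewardLaw T μ).real (badEvent q T μ)
      ≤ K * (2 * Real.exp (-2 * firstDraws K q T * confWidth K q T ^ 2)) := by
  have hset : badEvent q T μ
      = ⋃ i, {ω | confWidth K q T ≤ |empMean ω i (firstDraws K q T) - μ i|} := by
    ext ω; simp [badEvent]
  rw [hset]
  refine (measureReal_iUnion_fintype_le _).trans ?_
  refine (Finset.sum_le_sum fun i _ => rewardLaw_real_empMean_deviation_le μ i hT h0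
    (Real.sqrt_nonneg _)).trans ?_
  rw [Finset.sum_const, Finset.card_univ, Fintype.card_fin, nsmul_eq_mul, confWidth]

end TSE

namespace TSE

open scoped ENNReal

/-! ### Conditional densities -/

namespace IsCondDensity

variable {Ω α β : Type*} [MeasurableSpace Ω] [MeasurableSpace α] [MeasurableSpace β]
  {H : Measure Ω} {X : Ω → α} {Y : Ω → β} {ν : Measure α} [SFinite ν]
  {h : α → β → ℝ}

lemma lintegral_eq [IsProbabilityMeasure H] (hd : IsCondDensity H X Y ν h) (hX : Measurable X) (hY : Measurable Y)
    {f : β × α → ℝ≥0∞} (hf : Measurable f) :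
    ∫⁻ ω, f (Y ω, X ω) ∂H = ∫⁻ y, ∫⁻ x, f (y, x) * ENNReal.ofReal (h x y) ∂ν ∂(H.map Y) := by
  have hm : Measurable fun p : β × α => ENNReal.ofReal (h p.2 p.1) :=
    (hd.measurable.comp measurable_swap).ennreal_ofReal
  have e : ∫⁻ ω, f (Y ω, X ω) ∂H = ∫⁻ p, f p ∂(H.map fun ω => (Y ω, X ω)) :=
    (lintegral_map hf (hY.prodMk hX)).symm
  have := Measure.isProbabilityMeasure_map (μ := H) hY.aemeasurable
  rw [e, hd.joint, lintegral_withDensity_eq_lintegral_mul _ hm hf, lintegral_prod]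
  · simp only [Pi.mul_apply, mul_comm]
  · exact (hm.mul hf).aemeasurable

lemma lintegral_lintegral_eq_one [IsProbabilityMeasure H] (hd : IsCondDensity H X Y ν h) (hX : Measurable X)
    (hY : Measurable Y) : ∫⁻ y, ∫⁻ x, ENNReal.ofReal (h x y) ∂ν ∂(H.map Y) = 1 := by
  have := hd.lintegral_eq hX hY (f := fun _ => 1) measurable_const
  simpa using this.symm

lemma measurable_lintegral (hd : IsCondDensity H X Y ν h) :
    Measurable fun y => ∫⁻ x, ENNReal.ofReal (h x y) ∂ν :=
  Measurable.lintegral_prod_right' (f := fun p : β × α => ENNReal.ofReal (h p.2 p.1))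
    (hd.measurable.comp measurable_swap).ennreal_ofReal

lemma lintegral_one_add_mul [IsProbabilityMeasure H] (hd : IsCondDensity H X Y ν h) (hX : Measurable X)
    (hY : Measurable Y) (C : ℝ≥0∞) :
    ∫⁻ y, (1 + C * ∫⁻ x, ENNReal.ofReal (h x y) ∂ν) ∂(H.map Y) = 1 + C := by
  have := Measure.isProbabilityMeasure_map (μ := H) hY.aemeasurable
  rw [lintegral_add_left measurable_const, lintegral_const_mul _ hd.measurable_lintegral,
    hd.lintegral_lintegral_eq_one hX hY]
  simp

end IsCondDensity

/-- A density that varies by at most `1` on sets of measure at least `1 / C` is bounded in terms of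
its integral. -/
lemma ofReal_le_one_add_mul_lintegral {α : Type*} [MeasurableSpace α] {ν : Measure α} {g : α → ℝ}
    (hg : Measurable g) {C : ℝ≥0∞} {x : α} {A : Set α} (hA : 1 ≤ C * ν A)
    (hx : ∀ x' ∈ A, g x ≤ g x' + 1) :
    ENNReal.ofReal (g x) ≤ 1 + C * ∫⁻ x', ENNReal.ofReal (g x') ∂ν := by
  rw [← tsub_le_iff_left]
  have h1 : (ENNReal.ofReal (g x) - 1) * ν A ≤ ∫⁻ x', ENNReal.ofReal (g x') ∂ν := by
    rw [← setLIntegral_const]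
    refine (setLIntegral_mono hg.ennreal_ofReal fun x' hx' => ?_).trans (setLIntegral_le_lintegral _ _)
    rw [tsub_le_iff_right]
    calc ENNReal.ofReal (g x) ≤ ENNReal.ofReal (g x' + 1) := ENNReal.ofReal_le_ofReal (hx x' hx')
      _ ≤ ENNReal.ofReal (g x') + ENNReal.ofReal 1 := ENNReal.ofReal_add_le
      _ = _ := by simp
  calc ENNReal.ofReal (g x) - 1 = (ENNReal.ofReal (g x) - 1) * 1 := (mul_one _).symm
    _ ≤ (ENNReal.ofReal (g x) - 1) * (C * ν A) := by gcongr
    _ = C * ((ENNReal.ofReal (g x) - 1) * ν A) := by ring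
    _ ≤ _ := by gcongr

/-- On the side of `x` that faces the midpoint, an interval of length `δ ≤ 1/2` still fits into the
unit interval. -/
lemma le_volume_near {δ : ℝ} (h0 : 0 < δ) (h1 : δ ≤ 1 / 2) (x : I) :
    ENNReal.ofReal δ ≤ volume {x' : I | |(x : ℝ) - x'| ≤ δ} := by
  rcases le_total (x : ℝ) (1 / 2) with hx | hx
  · have hI : (x : ℝ) + δ ∈ I := ⟨by linarith [x.2.1], by linarith⟩
    calc ENNReal.ofReal δ = volume (Set.Icc x ⟨x + δ, hI⟩) := by simp
      _ ≤ _ := measure_mono fun x' hx' => by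
        have a1 : (x : ℝ) ≤ x' := hx'.1
        have a2 : (x' : ℝ) ≤ x + δ := hx'.2
        simp only [Set.mem_ofPred_eq, abs_le]
        constructor <;> linarith
  · have hI : (x : ℝ) - δ ∈ I := ⟨by linarith, by linarith [x.2.2]⟩
    calc ENNReal.ofReal δ = volume (Set.Icc ⟨x - δ, hI⟩ x) := by simp
      _ ≤ _ := measure_mono fun x' hx' => by
        have a1 : (x : ℝ) - δ ≤ x' := hx'.1
        have a2 : (x' : ℝ) ≤ x := hx'.2
        simp only [Set.mem_ofPred_eq, abs_le]
        constructor <;> linarith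

lemma volume_near_le (r : ℝ) (u : I) :
    volume {x : I | |(x : ℝ) - u| ≤ r} ≤ ENNReal.ofReal (2 * r) := by
  rw [unitInterval.volume_apply]
  calc _ ≤ volume (Set.Icc ((u : ℝ) - r) (u + r)) := measure_mono (by
        rintro _ ⟨x, hx, rfl⟩
        simp only [Set.mem_ofPred_eq, abs_le] at hx
        constructor <;> linarith)
    _ = _ := by rw [Real.volume_Icc]; congr 1; ring

variable {K : ℕ} {H : Measure (Fin K → I)}
  {h : (i : Fin K) → I → ({j : Fin K // j ≠ i} → I) → ℝ}
  {h₂ : (i j : Fin K) → I × I → ({k : Fin K // k ≠ i ∧ k ≠ j} → I) → ℝ}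

lemma measurable_except (i : Fin K) : Measurable (except i) :=
  measurable_pi_lambda _ fun j => measurable_pi_apply (j : Fin K)

lemma measurable_except₂ (i j : Fin K) : Measurable (except₂ i j) :=
  measurable_pi_lambda _ fun k => measurable_pi_apply (k : Fin K)

lemma measurableSet_closeTriples (r : ℝ) : MeasurableSet (closeTriples K r) := by
  have e : closeTriples K r = ⋃ t : Fin K × Fin K × Fin K,
      {μ | t.1 ≠ t.2.1 ∧ t.1 ≠ t.2.2 ∧ t.2.1 ≠ t.2.2 ∧
        |(μ t.1 : ℝ) - μ t.2.2| ≤ r ∧ |(μ t.2.1 : ℝ) - μ t.2.2| ≤ r} := by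
    ext μ
    simp [closeTriples]
  have hm : ∀ i j, Measurable fun μ : Fin K → I => |(μ i : ℝ) - μ j| := fun i j => by fun_prop
  rw [e]
  refine MeasurableSet.iUnion fun t => ?_
  refine (MeasurableSet.const _).inter ((MeasurableSet.const _).inter ((MeasurableSet.const _).inter
    (MeasurableSet.inter ?_ ?_)))
  · exact measurableSet_le (hm t.1 t.2.2) measurable_const
  · exact measurableSet_le (hm t.2.1 t.2.2) measurable_const

/-! ### Consequences of the uniform continuity of the densities -/

namespace UniformlyContinuousDensities

/-- Uniform continuity makes the density bounded in terms of its mass. The integral is kept because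
a conditional density has mass `1` only for almost every `y`; averaged over `y` the bound becomes `1
+ C`. -/
lemma exists_le (hH : UniformlyContinuousDensities H h h₂) :
    ∃ C : ℝ≥0∞, C ≠ ∞ ∧ ∀ i x y,
      ENNReal.ofReal (h i x y) ≤ 1 + C * ∫⁻ x', ENNReal.ofReal (h i x' y) := by
  obtain ⟨δ, hδ, hc⟩ := hH.unifCont 1 one_pos
  have hδ' : 0 < min δ (1 / 2) := lt_min hδ (by norm_num)
  have hne : ENNReal.ofReal (min δ (1 / 2)) ≠ 0 := by simpa using hδ
  refine ⟨(ENNReal.ofReal (min δ (1 / 2)))⁻¹, ENNReal.inv_ne_top.2 hne, fun i x y => ?_⟩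
  refine ofReal_le_one_add_mul_lintegral (A := {x' : I | |(x : ℝ) - x'| ≤ min δ (1 / 2)})
    (g := fun x => h i x y)
    ((hH.density i).measurable.comp (measurable_id.prodMk measurable_const)) ?_ ?_
  · calc (1 : ℝ≥0∞) = (ENNReal.ofReal (min δ (1 / 2)))⁻¹ * ENNReal.ofReal (min δ (1 / 2)) :=
        (ENNReal.inv_mul_cancel hne ENNReal.ofReal_ne_top).symm
      _ ≤ _ := by gcongr; exact le_volume_near hδ' (min_le_right _ _) x
  · intro x' hx'
    have := (abs_le.1 (hc i y x x' (le_trans hx' (min_le_left _ _)))).2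
    show h i x y ≤ h i x' y + 1
    linarith

lemma exists_le₂ (hH : UniformlyContinuousDensities H h h₂) :
    ∃ C : ℝ≥0∞, C ≠ ∞ ∧ ∀ i j, i ≠ j → ∀ p y,
      ENNReal.ofReal (h₂ i j p y) ≤ 1 + C * ∫⁻ p', ENNReal.ofReal (h₂ i j p' y) := by
  obtain ⟨δ, hδ, hc⟩ := hH.unifCont₂ 1 one_pos
  have hδ' : 0 < min δ (1 / 2) := lt_min hδ (by norm_num)
  set d := ENNReal.ofReal (min δ (1 / 2)) with hd
  have hne : d ≠ 0 := by simpa [hd] using hδ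
  have hne2 : d * d ≠ 0 := mul_ne_zero hne hne
  refine ⟨(d * d)⁻¹, ENNReal.inv_ne_top.2 hne2, fun i j hij p y => ?_⟩
  refine ofReal_le_one_add_mul_lintegral
    (A := {x' : I | |(p.1 : ℝ) - x'| ≤ min δ (1 / 2)} ×ˢ {x' : I | |(p.2 : ℝ) - x'| ≤ min δ (1 / 2)})
    (g := fun p => h₂ i j p y)
    ((hH.density₂ i j hij).measurable.comp (measurable_id.prodMk measurable_const)) ?_ ?_
  · rw [Measure.volume_eq_prod, Measure.prod_prod]
    calc (1 : ℝ≥0∞) = (d * d)⁻¹ * (d * d) :=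
        (ENNReal.inv_mul_cancel hne2 (ENNReal.mul_ne_top ENNReal.ofReal_ne_top
          ENNReal.ofReal_ne_top)).symm
      _ ≤ _ := by
        gcongr
        · exact le_volume_near hδ' (min_le_right _ _) p.1
        · exact le_volume_near hδ' (min_le_right _ _) p.2
  · intro p' hp'
    have := (abs_le.1 (hc i j hij y p.1 p'.1 p.2 p'.2 (le_trans hp'.1 (min_le_left _ _))
      (le_trans hp'.2 (min_le_left _ _)))).2
    show h₂ i j p y ≤ h₂ i j p' y + 1
    linarith

lemma integrable_density_best [IsProbabilityMeasure H]
    (hH : UniformlyContinuousDensities H h h₂) (i : Fin K) :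
    Integrable (fun y => h i (best y) y) (H.map (except i)) := by
  obtain ⟨C, hC, hle⟩ := hH.exists_le
  have hd := hH.density i
  refine ⟨(hd.measurable.comp (measurable_best.prodMk measurable_id)).aestronglyMeasurable, ?_⟩
  rw [hasFiniteIntegral_iff_ofReal (ae_of_all _ fun y => hd.nonneg _ _)]
  calc _ ≤ ∫⁻ y, (1 + C * ∫⁻ x', ENNReal.ofReal (h i x' y)) ∂(H.map (except i)) :=
        lintegral_mono fun y => hle i _ y
    _ = 1 + C := hd.lintegral_one_add_mul (measurable_pi_apply i) (measurable_except i) C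
    _ < ∞ := by simpa using hC.lt_top

lemma integrable_optIntegrand [IsProbabilityMeasure H]
    (hH : UniformlyContinuousDensities H h h₂) (i : Fin K) :
    Integrable (optIntegrand h i) (H.map (except i)) := by
  have hb : Measurable fun y : {j : Fin K // j ≠ i} → I => (best y : ℝ) :=
    measurable_subtype_coe.comp measurable_best
  refine (hH.integrable_density_best i).mono
    (((hb.mul (hb.const_sub 1)).mul ((hH.density i).measurable.comp
      (measurable_best.prodMk measurable_id))).aestronglyMeasurable) (ae_of_all _ fun y => ?_)
  have h0 := (best y).2.1
  have h1 := (best y).2.2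
  have h2 : 0 ≤ 1 - (best y : ℝ) := by linarith
  rw [optIntegrand, norm_mul]
  refine mul_le_of_le_one_left (norm_nonneg _) ?_
  rw [Real.norm_of_nonneg (by positivity)]
  nlinarith

/-- Conditionally on the arms other than `i` and `j`, the mean of `k` is fixed, and the event places
`(μ i, μ j)` in a square of side at most `2r`, where the joint density is controlled by
`exists_le₂`. -/
lemma measure_close_le [IsProbabilityMeasure H]
    (hH : UniformlyContinuousDensities H h h₂) :
    ∃ C : ℝ≥0∞, C ≠ ∞ ∧ ∀ r : ℝ, ∀ i j k, i ≠ j → i ≠ k → j ≠ k →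
      H {μ | |(μ i : ℝ) - μ k| ≤ r ∧ |(μ j : ℝ) - μ k| ≤ r} ≤ ENNReal.ofReal (2 * r) ^ 2 * (1 + C) := by
  obtain ⟨C, hC, hle⟩ := hH.exists_le₂
  refine ⟨C, hC, fun r i j k hij hik hjk => ?_⟩
  have hd := hH.density₂ i j hij
  let k' : {l : Fin K // l ≠ i ∧ l ≠ j} := ⟨k, hik.symm, hjk.symm⟩
  let S : Set (({l : Fin K // l ≠ i ∧ l ≠ j} → I) × (I × I)) :=
    {p | |(p.2.1 : ℝ) - p.1 k'| ≤ r ∧ |(p.2.2 : ℝ) - p.1 k'| ≤ r}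
  have hS : MeasurableSet S := by
    have m1 : Measurable fun p : ({l : Fin K // l ≠ i ∧ l ≠ j} → I) × (I × I) =>
        |(p.2.1 : ℝ) - p.1 k'| := by fun_prop
    have m2 : Measurable fun p : ({l : Fin K // l ≠ i ∧ l ≠ j} → I) × (I × I) =>
        |(p.2.2 : ℝ) - p.1 k'| := by fun_prop
    exact (measurableSet_le m1 measurable_const).inter (measurableSet_le m2 measurable_const)
  have e := hd.lintegral_eq ((measurable_pi_apply i).prodMk (measurable_pi_apply j))
    (measurable_except₂ i j) (f := S.indicator 1) (measurable_one.indicator hS)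
  have e1 : ∫⁻ μ, S.indicator 1 (except₂ i j μ, (μ i, μ j)) ∂H
      = H {μ | |(μ i : ℝ) - μ k| ≤ r ∧ |(μ j : ℝ) - μ k| ≤ r} := by
    rw [← lintegral_indicator_one]
    · rfl
    · exact hS.preimage ((measurable_except₂ i j).prodMk
        ((measurable_pi_apply i).prodMk (measurable_pi_apply j)))
  rw [← e1, e, ← hd.lintegral_one_add_mul ((measurable_pi_apply i).prodMk (measurable_pi_apply j))
    (measurable_except₂ i j) C, ← lintegral_const_mul _ (by
      exact measurable_const.add (hd.measurable_lintegral.const_mul C))]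
  refine lintegral_mono fun y => ?_
  calc ∫⁻ p, S.indicator 1 (y, p) * ENNReal.ofReal (h₂ i j p y)
      ≤ ∫⁻ p, ({x : I | |(x : ℝ) - y k'| ≤ r} ×ˢ {x : I | |(x : ℝ) - y k'| ≤ r}).indicator 1 p
        * (1 + C * ∫⁻ p', ENNReal.ofReal (h₂ i j p' y)) :=
        lintegral_mono fun p => mul_le_mul' le_rfl (hle i j hij p y)
    _ = volume ({x : I | |(x : ℝ) - y k'| ≤ r} ×ˢ {x : I | |(x : ℝ) - y k'| ≤ r})
        * (1 + C * ∫⁻ p', ENNReal.ofReal (h₂ i j p' y)) := by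
        have hm : MeasurableSet {x : I | |(x : ℝ) - y k'| ≤ r} :=
          measurableSet_le (by fun_prop) measurable_const
        rw [lintegral_mul_const _ (measurable_one.indicator (hm.prod hm)),
          lintegral_indicator_one (hm.prod hm)]
    _ ≤ _ := by
        rw [Measure.volume_eq_prod, Measure.prod_prod, sq]
        gcongr <;> exact volume_near_le r (y k')

lemma exists_measureReal_closeTriples_le [IsProbabilityMeasure H]
    (hH : UniformlyContinuousDensities H h h₂) :
    ∃ C : ℝ, 0 ≤ C ∧ ∀ r : ℝ, 0 ≤ r → H.real (closeTriples K r) ≤ C * r ^ 2 := by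
  obtain ⟨C, hC, hle⟩ := hH.measure_close_le
  refine ⟨(K : ℝ) ^ 3 * (4 * (1 + C).toReal), by positivity, fun r hr => ?_⟩
  have hsub : closeTriples K r ⊆ ⋃ t : Fin K × Fin K × Fin K,
      {μ | t.1 ≠ t.2.1 ∧ t.1 ≠ t.2.2 ∧ t.2.1 ≠ t.2.2 ∧
        |(μ t.1 : ℝ) - μ t.2.2| ≤ r ∧ |(μ t.2.1 : ℝ) - μ t.2.2| ≤ r} := by
    rintro μ ⟨i, j, k, hμ⟩
    exact Set.mem_iUnion.2 ⟨(i, j, k), hμ⟩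
  have hone : ∀ t : Fin K × Fin K × Fin K, H.real {μ | t.1 ≠ t.2.1 ∧ t.1 ≠ t.2.2 ∧ t.2.1 ≠ t.2.2 ∧
        |(μ t.1 : ℝ) - μ t.2.2| ≤ r ∧ |(μ t.2.1 : ℝ) - μ t.2.2| ≤ r}
      ≤ 4 * (1 + C).toReal * r ^ 2 := by
    rintro ⟨i, j, k⟩
    have hnn : 0 ≤ 4 * (1 + C).toReal * r ^ 2 := by positivity
    by_cases hd : i ≠ j ∧ i ≠ k ∧ j ≠ k
    · refine ENNReal.toReal_le_of_le_ofReal hnn ?_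
      refine (measure_mono fun μ hμ => ?_).trans ((hle r i j k hd.1 hd.2.1 hd.2.2).trans (le_of_eq ?_))
      · exact hμ.2.2.2
      · rw [← ENNReal.ofReal_toReal (a := 1 + C) (by simpa using hC),
          ← ENNReal.ofReal_pow (by positivity), ← ENNReal.ofReal_mul (by positivity),
          ENNReal.ofReal_toReal (by simpa using hC)]
        congr 1; ring
    · have : {μ : Fin K → I | i ≠ j ∧ i ≠ k ∧ j ≠ k ∧ |(μ i : ℝ) - μ k| ≤ r ∧
          |(μ j : ℝ) - μ k| ≤ r} = ∅ := by
        ext μ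
        simp only [Set.mem_ofPred_eq, Set.mem_empty_iff_false, iff_false]
        rintro ⟨h1, h2, h3, -⟩; exact hd ⟨h1, h2, h3⟩
      simp only [this, measureReal_empty]; exact hnn
  calc H.real (closeTriples K r) ≤ _ := measureReal_mono hsub
    _ ≤ _ := measureReal_iUnion_fintype_le _
    _ ≤ ∑ _t : Fin K × Fin K × Fin K, 4 * (1 + C).toReal * r ^ 2 :=
        Finset.sum_le_sum fun t _ => hone t
    _ = _ := by
        rw [Finset.sum_const, nsmul_eq_mul, Finset.card_univ]
        simp only [Fintype.card_prod, Fintype.card_fin]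
        push_cast; ring

/-- The contribution of the comparisons of arm `i` with the best of the others. -/
lemma integral_localLoss_le [IsProbabilityMeasure H]
    (hH : UniformlyContinuousDensities H h h₂) {ε δ : ℝ} (hε : 0 ≤ ε)
    (hδ : ∀ i y, ∀ x x' : I, |(x : ℝ) - x'| ≤ δ → |h i x y - h i x' y| ≤ ε) (i : Fin K) {n : ℕ}
    (hn : 1 ≤ n) {r : ℝ} (hr : r ≤ δ) :
    Integrable (fun μ => localLoss n r (μ i) (best (except i μ))) H ∧
    ∫ μ, localLoss n r (μ i) (best (except i μ)) ∂H
      ≤ (∫ y, optIntegrand h i y ∂(H.map (except i)) + ε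
        + 2 / √n * (∫ y, h i (best y) y ∂(H.map (except i)) + ε)) / n := by
  have := Measure.isProbabilityMeasure_map (μ := H) (measurable_except i).aemeasurable
  have hd := hH.density i
  have hb : Measurable fun y : {j : Fin K // j ≠ i} → I => (best y : ℝ) :=
    measurable_subtype_coe.comp measurable_best
  have hn' : (0 : ℝ) < n := by exact_mod_cast hn
  have hI1 := hH.integrable_optIntegrand i
  have hI2 := hH.integrable_density_best i
  have hm : Measurable fun p : ({j : Fin K // j ≠ i} → I) × I => localLoss n r p.2 (best p.1) :=
    (measurable_localLoss n r).comp ((measurable_subtype_coe.comp measurable_snd).prodMk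
      (hb.comp measurable_fst))
  have hnn : ∀ μ : Fin K → I, 0 ≤ localLoss n r (μ i) (best (except i μ)) := fun μ =>
    localLoss_nonneg n r (μ i) (best (except i μ))
  have hmm : Measurable fun μ : Fin K → I => localLoss n r (μ i) (best (except i μ)) :=
    hm.comp ((measurable_except i).prodMk (measurable_pi_apply i))
  -- Bound for the conditional expectation given `y`: the integral of `pairLoss` over uniform `x`,
  -- times the density frozen at `best y` with error `ε`.
  let G : ({j : Fin K // j ≠ i} → I) → ℝ := fun y =>
    (((best y : ℝ) * (1 - best y) + 2 / √n) / n) * (h i (best y) y + ε)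
  have hGnn : ∀ y, 0 ≤ G y := fun y => by
    have h0 := (best y).2.1
    have h1 : 0 ≤ 1 - (best y : ℝ) := by linarith [(best y).2.2]
    have := hd.nonneg (best y) y
    positivity
  have hGe : G = fun y => (optIntegrand h i y + ε * ((best y : ℝ) * (1 - best y))
      + 2 / √n * (h i (best y) y + ε)) / n := by
    funext y; simp only [G, optIntegrand]; ring
  have hI3 : Integrable (fun y : {j : Fin K // j ≠ i} → I => (best y : ℝ) * (1 - best y))
      (H.map (except i)) :=
    Integrable.of_mem_Icc 0 1 (hb.mul (hb.const_sub 1)).aemeasurable (ae_of_all _ fun y => by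
      have h0 := (best y).2.1
      have h1 := (best y).2.2
      constructor <;> nlinarith)
  have hGi : Integrable G (H.map (except i)) := by
    rw [hGe]
    exact ((hI1.add (hI3.const_mul ε)).add ((hI2.add (integrable_const ε)).const_mul _)).div_const _
  have hGint : ∫ y, G y ∂(H.map (except i))
      ≤ (∫ y, optIntegrand h i y ∂(H.map (except i)) + ε
        + 2 / √n * (∫ y, h i (best y) y ∂(H.map (except i)) + ε)) / n := by
    have h3 : ∫ y, (best y : ℝ) * (1 - best y) ∂(H.map (except i)) ≤ 1 := by
      calc _ ≤ ∫ y, (1 : ℝ) ∂(H.map (except i)) :=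
            integral_mono hI3 (integrable_const _) fun y => by
              have h0 := (best y).2.1
              have h1 := (best y).2.2
              show (best y : ℝ) * (1 - best y) ≤ 1
              nlinarith
        _ = 1 := by simp
    rw [hGe, integral_div, integral_add, integral_add hI1 (hI3.const_mul ε), integral_const_mul,
      integral_const_mul, integral_add hI2 (integrable_const ε)]
    · simp only [integral_const, probReal_univ, one_smul]
      gcongr
      nlinarith
    · exact hI1.add (hI3.const_mul ε)
    · exact (hI2.add (integrable_const ε)).const_mul _
  have hl : ∫⁻ μ, ENNReal.ofReal (localLoss n r (μ i) (best (except i μ))) ∂H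
      ≤ ENNReal.ofReal (∫ y, G y ∂(H.map (except i))) := by
    have e := hd.lintegral_eq (measurable_pi_apply i) (measurable_except i) hm.ennreal_ofReal
    rw [e, ofReal_integral_eq_lintegral_ofReal hGi (ae_of_all _ hGnn)]
    refine lintegral_mono fun y => ?_
    -- The cut-off at `r ≤ δ` serves only to freeze the density. Afterwards it is dropped, since
    -- `pairLoss` is integrated over all of `I`.
    calc ∫⁻ x : I, ENNReal.ofReal (localLoss n r x (best y)) * ENNReal.ofReal (h i x y)
        ≤ ∫⁻ x : I, ENNReal.ofReal (pairLoss n x (best y))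
          * ENNReal.ofReal (h i (best y) y + ε) := by
          refine lintegral_mono fun x => ?_
          simp only [localLoss]
          split_ifs with hx
          · gcongr
            have := (abs_le.1 (hδ i y x (best y) (hx.trans hr))).2
            linarith
          · simp
      _ = (∫⁻ x : I, ENNReal.ofReal (pairLoss n x (best y)))
          * ENNReal.ofReal (h i (best y) y + ε) := by
          rw [lintegral_mul_const]
          exact ((measurable_pairLoss n).comp (measurable_subtype_coe.prodMk
            measurable_const)).ennreal_ofReal
      _ ≤ ENNReal.ofReal (((best y : ℝ) * (1 - best y) + 2 / √n) / n)
          * ENNReal.ofReal (h i (best y) y + ε) := by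
          gcongr
          exact lintegral_pairLoss_le n hn (best y)
      _ = ENNReal.ofReal (G y) := by
          rw [← ENNReal.ofReal_mul]
          have h0 := (best y).2.1
          have h1 : 0 ≤ 1 - (best y : ℝ) := by linarith [(best y).2.2]
          positivity
  constructor
  · refine ⟨hmm.aestronglyMeasurable, ?_⟩
    rw [hasFiniteIntegral_iff_ofReal (ae_of_all _ hnn)]
    exact hl.trans_lt ENNReal.ofReal_lt_top
  · refine le_trans ?_ hGint
    rw [integral_eq_lintegral_of_nonneg_ae (ae_of_all _ hnn) hmm.aestronglyMeasurable]
    exact ENNReal.toReal_le_of_le_ofReal (integral_nonneg hGnn) hl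

end UniformlyContinuousDensities

end TSE

namespace TSE

/-! ### Asymptotics -/

variable {K : ℕ} {q : ℝ}

lemma effHorizon_coeff_pos (hK : 2 ≤ K) (hq0 : 0 < q) (hq1 : q < 1) : 0 < q / K + (1 - q) := by
  have : 0 ≤ q / K := by positivity
  linarith

lemma pairDraws_le (hK : 2 ≤ K) (hq0 : 0 < q) (hq1 : q < 1) (T : ℕ) : pairDraws K q T ≤ T := by
  have hK' : (2 : ℝ) ≤ K := by exact_mod_cast hK
  have h1 : (firstDraws K q T : ℝ) ≤ q * T / K := Nat.floor_le (by positivity)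
  have h2 : (secondDraws q T 2 : ℝ) ≤ (1 - q) * T / (2 : ℕ) :=
    Nat.floor_le (by have : 0 ≤ 1 - q := by linarith
                     positivity)
  have h3 : q * T / K ≤ q * T / 2 := by gcongr
  have h4 : (pairDraws K q T : ℝ) ≤ T := by
    unfold pairDraws
    push_cast at h2 ⊢
    have : (0 : ℝ) ≤ T := by positivity
    linarith
  exact_mod_cast h4

/-- Twice the number of draws is about `2qT/K + (1-q)T`. The surplus `qT/K` over the effective
horizon pays for the two roundings, which cost at most `4` after doubling. -/
lemma effHorizon_le_two_mul_pairDraws {T : ℕ} (h4 : 4 ≤ q * T / K) :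
    effHorizon K q T ≤ 2 * pairDraws K q T := by
  have h1 : q * T / K - 1 < firstDraws K q T := Nat.sub_one_lt_floor _
  have h2 : (1 - q) * T / (2 : ℕ) - 1 < secondDraws q T 2 := Nat.sub_one_lt_floor _
  have h3 : effHorizon K q T = q * T / K + (1 - q) * T := by unfold effHorizon; ring
  unfold pairDraws
  push_cast at h2 ⊢
  linarith

/-- Rounding loses at most a quarter of `qT/K ≥ 4`, so the exponential is at most `T^(-3/2)`, and
`T^(-1/2)` is left after multiplication by `T`. -/
lemma exp_le_of_four_le (hK : 2 ≤ K) (hq0 : 0 < q) {T : ℕ} (h4 : 4 ≤ q * T / K) :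
    T * Real.exp (-2 * firstDraws K q T * confWidth K q T ^ 2)
      ≤ Real.exp (-(1 / 2 * Real.log T)) := by
  have hK' : (0 : ℝ) < K := by positivity
  have hT : 0 < T := by
    rcases Nat.eq_zero_or_pos T with h | h
    · subst h; norm_num at h4
    · exact h
  have hT' : (0 : ℝ) < T := by exact_mod_cast hT
  have hlog : 0 ≤ Real.log T := Real.log_natCast_nonneg T
  have hB : confWidth K q T ^ 2 = K * Real.log T / (q * T) := Real.sq_sqrt (by positivity)
  have h1 : q * T / K - 1 < firstDraws K q T := Nat.sub_one_lt_floor _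
  have h34 : 3 / 4 * (q * T / K) ≤ firstDraws K q T := by linarith
  have h2 : 3 / 4 * Real.log T ≤ firstDraws K q T * confWidth K q T ^ 2 := by
    calc 3 / 4 * Real.log T = 3 / 4 * (q * T / K) * (K * Real.log T / (q * T)) := by field_simp
      _ ≤ _ := by rw [hB]; gcongr
  calc T * Real.exp (-2 * firstDraws K q T * confWidth K q T ^ 2)
      = Real.exp (Real.log T + -2 * firstDraws K q T * confWidth K q T ^ 2) := by
        rw [Real.exp_add, Real.exp_log hT']
    _ ≤ _ := Real.exp_le_exp.2 (by linarith)

lemma eventually_four_le (hK : 2 ≤ K) (hq0 : 0 < q) : ∀ᶠ T : ℕ in atTop, 4 ≤ q * T / K := by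
  have hK' : (0 : ℝ) < K := by positivity
  have h : Tendsto (fun T : ℕ => q * T / K) atTop atTop :=
    (tendsto_natCast_atTop_atTop.const_mul_atTop hq0).atTop_div_const hK'
  exact h.eventually_ge_atTop 4

lemma tendsto_mul_exp (hK : 2 ≤ K) (hq0 : 0 < q) :
    Tendsto (fun T : ℕ => T * Real.exp (-2 * firstDraws K q T * confWidth K q T ^ 2)) atTop
      (𝓝 0) := by
  have hlog : Tendsto (fun T : ℕ => Real.log T) atTop atTop :=
    Real.tendsto_log_atTop.comp tendsto_natCast_atTop_atTop
  have h : Tendsto (fun T : ℕ => Real.exp (-(1 / 2 * Real.log T))) atTop (𝓝 0) :=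
    Real.tendsto_exp_atBot.comp (tendsto_neg_atTop_atBot.comp
      (hlog.const_mul_atTop (by norm_num)))
  have h4 := eventually_four_le hK hq0
  exact squeeze_zero' (Eventually.of_forall fun T => by positivity)
    (h4.mono fun T hT => exp_le_of_four_le hK hq0 hT) h

lemma tendsto_log_pow_div (k : ℕ) :
    Tendsto (fun T : ℕ => Real.log T ^ k / T) atTop (𝓝 0) :=
  ((Real.isLittleO_pow_log_id_atTop (n := k)).tendsto_div_nhds_zero).comp tendsto_natCast_atTop_atTop

lemma tendsto_confWidth : Tendsto (confWidth K q) atTop (𝓝 0) := by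
  have h : Tendsto (fun T : ℕ => √((K / q) * (Real.log T ^ 1 / T))) atTop (𝓝 (√((K / q) * 0))) :=
    ((tendsto_log_pow_div 1).const_mul _).sqrt
  rw [mul_zero, Real.sqrt_zero] at h
  refine h.congr fun T => ?_
  rw [confWidth]; congr 1; rw [pow_one, div_mul_div_comm]

/-- Since `T B² = (K/q) log T`, the quantity equals `(K/q) log T · B`, of order `√(log³ T / T)`. -/
lemma tendsto_mul_confWidth_pow (hq0 : 0 < q) :
    Tendsto (fun T : ℕ => T * confWidth K q T ^ 3) atTop (𝓝 0) := by
  have h : Tendsto (fun T : ℕ => (K / q) * √((K / q) * (Real.log T ^ 3 / T))) atTop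
      (𝓝 ((K / q) * √((K / q) * 0))) :=
    (((tendsto_log_pow_div 3).const_mul _).sqrt).const_mul _
  rw [mul_zero, Real.sqrt_zero, mul_zero] at h
  refine h.congr' ((eventually_gt_atTop 0).mono fun T hT => ?_)
  have hT' : (0 : ℝ) < T := by exact_mod_cast hT
  have hlog : 0 ≤ Real.log T := Real.log_natCast_nonneg T
  have hB : confWidth K q T ^ 2 = K * Real.log T / (q * T) := Real.sq_sqrt (by positivity)
  have e : √((K / q) * (Real.log T ^ 3 / T)) = Real.log T * confWidth K q T := by
    rw [confWidth, show (K / q) * (Real.log T ^ 3 / T)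
      = Real.log T ^ 2 * (K * Real.log T / (q * T)) by field_simp,
      Real.sqrt_mul (by positivity), Real.sqrt_sq hlog]
  show K / q * √((K / q) * (Real.log T ^ 3 / T)) = T * confWidth K q T ^ 3
  rw [e, pow_succ _ 2, hB]
  field_simp

end TSE

/-! ### The Bayesian regret: assembly of the bounds -/

namespace TSE.UniformlyContinuousDensities

variable {K : ℕ} {H : Measure (Fin K → I)}
  {h : (i : Fin K) → I → ({j : Fin K // j ≠ i} → I) → ℝ}
  {h₂ : (i j : Fin K) → I × I → ({k : Fin K // k ≠ i ∧ k ≠ j} → I) → ℝ} {q : ℝ}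

lemma optConst_nonneg (hH : UniformlyContinuousDensities H h h₂) : 0 ≤ optConst H h :=
  Finset.sum_nonneg fun i _ => integral_nonneg fun y =>
    mul_nonneg (mul_nonneg (best y).2.1 (sub_nonneg.2 (best y).2.2)) ((hH.density i).nonneg _ _)

/-- A bound of the Bayesian simple regret for a fixed horizon. -/
lemma bayesRegret_le [IsProbabilityMeasure H] (hH : UniformlyContinuousDensities H h h₂) (hK : 2 ≤ K) (hq0 : 0 < q)
    (hq1 : q < 1) {C : ℝ} (hC : ∀ r : ℝ, 0 ≤ r → H.real (closeTriples K r) ≤ C * r ^ 2) {ε δ : ℝ}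
    (hε : 0 ≤ ε) (hδ : ∀ i y, ∀ x x' : I, |(x : ℝ) - x'| ≤ δ → |h i x y - h i x' y| ≤ ε)
    {T : ℕ} (hr : 4 * confWidth K q T ≤ δ) (h4 : 4 ≤ q * T / K) {J : Rewards K T → Fin K}
    (hJ : IsRecommendation q J) :
    bayesRegret H J ≤ K * (2 * Real.exp (-2 * firstDraws K q T * confWidth K q T ^ 2))
      + 64 * C * confWidth K q T ^ 3
      + (optConst H h + K * ε + 2 / √(pairDraws K q T)
          * (∑ i, ∫ y, h i (best y) y ∂(H.map (except i)) + K * ε)) / (2 * pairDraws K q T) := by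
  have hB : 0 ≤ confWidth K q T := Real.sqrt_nonneg _
  have h1 : q * T / K - 1 < firstDraws K q T := Nat.sub_one_lt_floor _
  have h1' : 0 < firstDraws K q T := by
    have : (0 : ℝ) < firstDraws K q T := by linarith
    exact_mod_cast this
  have hn0 : 0 < pairDraws K q T := by unfold pairDraws; omega
  have hnT := pairDraws_le hK hq0 hq1 T
  have h1T : firstDraws K q T ≤ T := le_trans (Nat.le_add_right _ _) hnT
  have hl := fun i => hH.integral_localLoss_le hε hδ i hn0 hr
  have hint1 : Integrable ((closeTriples K (4 * confWidth K q T)).indicator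
      fun _ => 4 * confWidth K q T) H :=
    (integrable_const _).indicator (measurableSet_closeTriples _)
  have hint12 := (integrable_const (μ := H)
    (K * (2 * Real.exp (-2 * firstDraws K q T * confWidth K q T ^ 2)))).add hint1
  simp only [Pi.add_def] at hint12
  have hint2 : Integrable (fun μ => 1 / 2 * ∑ i, localLoss (pairDraws K q T)
      (4 * confWidth K q T) (μ i) (best (except i μ))) H :=
    (integrable_finsetSum _ fun i _ => (hl i).1).const_mul _
  have hmono : bayesRegret H J ≤ ∫ μ, (K * (2 * Real.exp (-2 * firstDraws K q T
      * confWidth K q T ^ 2))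
      + (closeTriples K (4 * confWidth K q T)).indicator (fun _ => 4 * confWidth K q T) μ
      + 1 / 2 * ∑ i, localLoss (pairDraws K q T) (4 * confWidth K q T) (μ i)
        (best (except i μ))) ∂H := by
    refine integral_mono (integrable_regret J H) (hint12.add hint2)
      fun μ => (regret_le hK hJ hn0 hnT μ).trans ?_
    have := rewardLaw_real_badEvent_le μ h1' h1T
    linarith
  rw [integral_add hint12 hint2,
    integral_add (integrable_const _) hint1, integral_indicator (measurableSet_closeTriples _),
    integral_const_mul (1 / 2 : ℝ), integral_finsetSum _ fun i _ => (hl i).1] at hmono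
  simp only [integral_const, probReal_univ, measureReal_restrict_apply_univ,
    smul_eq_mul] at hmono
  -- Prior mass `C (4B)²` times loss `4B`; hence `64 = 4³`.
  have ht : H.real (closeTriples K (4 * confWidth K q T)) * (4 * confWidth K q T)
      ≤ 64 * C * confWidth K q T ^ 3 := by
    calc _ ≤ C * (4 * confWidth K q T) ^ 2 * (4 * confWidth K q T) := by
          gcongr; exact hC _ (by positivity)
      _ = _ := by ring
  have hs : 1 / 2 * ∑ i, ∫ μ, localLoss (pairDraws K q T) (4 * confWidth K q T) (μ i)
        (best (except i μ)) ∂H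
      ≤ (optConst H h + K * ε + 2 / √(pairDraws K q T)
          * (∑ i, ∫ y, h i (best y) y ∂(H.map (except i)) + K * ε)) / (2 * pairDraws K q T) := by
    refine (mul_le_mul_of_nonneg_left (Finset.sum_le_sum fun i _ => (hl i).2)
      (by norm_num)).trans (le_of_eq ?_)
    rw [← Finset.sum_div, Finset.sum_add_distrib, Finset.sum_add_distrib, ← Finset.mul_sum,
      Finset.sum_add_distrib]
    simp only [Finset.sum_const, Finset.card_univ, Fintype.card_fin, nsmul_eq_mul, optConst]
    ring
  linarith

lemma eventually_bayesRegret_le [IsProbabilityMeasure H]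
    (hH : UniformlyContinuousDensities H h h₂) (hK : 2 ≤ K)
    (hq0 : 0 < q) (hq1 : q < 1) {J : (T : ℕ) → Rewards K T → Fin K}
    (hJ : ∀ T, IsRecommendation q (J T)) {η : ℝ} (hη : 0 < η) :
    ∀ᶠ T : ℕ in atTop, bayesRegret H (J T) ≤ optConst H h / effHorizon K q T + η / T := by
  obtain ⟨C, hC0, hC⟩ := hH.exists_measureReal_closeTriples_le
  have hκ := effHorizon_coeff_pos hK hq0 hq1
  set κ := q / K + (1 - q) with hκdef
  have hK' : (0 : ℝ) < K := by positivity
  -- Error budget: `η/2` for the bad event and the close triples together, `κη/4` for `Kε`, and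
  -- `κη/4` for the `n^(-1/2)` term. The last two are divided by `κT` and give the other `η/(2T)`.
  set ε := κ * η / (4 * K) with hεdef
  have hε : 0 < ε := by positivity
  obtain ⟨δ, hδ, hc⟩ := hH.unifCont ε hε
  set D := ∑ i, ∫ y, h i (best y) y ∂(H.map (except i)) with hD
  have hD0 : 0 ≤ D := Finset.sum_nonneg fun i _ => integral_nonneg fun y =>
    (hH.density i).nonneg _ _
  have hT4 := eventually_four_le hK hq0
  have hw : ∀ᶠ T : ℕ in atTop, 4 * confWidth K q T ≤ δ := by
    have := (tendsto_confWidth (K := K) (q := q)).const_mul 4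
    rw [mul_zero] at this
    exact this.eventually_le_const hδ
  have hE : ∀ᶠ T : ℕ in atTop, 2 * K * (T * Real.exp (-2 * firstDraws K q T
      * confWidth K q T ^ 2)) + 64 * C * (T * confWidth K q T ^ 3) ≤ η / 2 := by
    have := ((tendsto_mul_exp hK hq0).const_mul (2 * (K : ℝ))).add
      ((tendsto_mul_confWidth_pow (K := K) hq0).const_mul (64 * C))
    simp only [mul_zero, add_zero] at this
    exact this.eventually_le_const (by positivity)
  have hS : ∀ᶠ T : ℕ in atTop, 2 / √(pairDraws K q T) * (D + K * ε) ≤ κ * η / 4 := by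
    have hn : Tendsto (fun T : ℕ => (pairDraws K q T : ℝ)) atTop atTop := by
      refine tendsto_atTop_mono' atTop (f₁ := fun T : ℕ => κ / 2 * T) ?_
        (tendsto_natCast_atTop_atTop.const_mul_atTop (by positivity))
      filter_upwards [hT4] with T hT
      have := effHorizon_le_two_mul_pairDraws hT
      rw [effHorizon, ← hκdef] at this
      linarith
    have := (Tendsto.const_div_atTop (Real.tendsto_sqrt_atTop.comp hn) (2 : ℝ)).mul_const (D + K * ε)
    rw [zero_mul] at this
    exact this.eventually_le_const (by positivity)
  filter_upwards [hT4, hw, hE, hS, eventually_gt_atTop 0] with T h4 hwT hET hST hT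
  have hT' : (0 : ℝ) < T := by exact_mod_cast hT
  have hb := hH.bayesRegret_le hK hq0 hq1 hC hε.le hc hwT h4 (hJ T)
  have he := effHorizon_le_two_mul_pairDraws h4
  have heq : effHorizon K q T = κ * T := rfl
  have hpos : 0 < effHorizon K q T := by rw [heq]; positivity
  have hopt := hH.optConst_nonneg
  have hKε : K * ε = κ * η / 4 := by rw [hεdef]; field_simp
  have hmain : (optConst H h + K * ε + 2 / √(pairDraws K q T) * (D + K * ε))
        / (2 * pairDraws K q T) ≤ optConst H h / effHorizon K q T + η / 2 / T := by
    calc _ ≤ (optConst H h + K * ε + 2 / √(pairDraws K q T) * (D + K * ε))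
          / effHorizon K q T := by gcongr
      _ ≤ (optConst H h + κ * η / 2) / effHorizon K q T := by
          gcongr ?_ / _
          linarith
      _ = _ := by rw [heq]; field_simp
  have hrest : K * (2 * Real.exp (-2 * firstDraws K q T * confWidth K q T ^ 2))
      + 64 * C * confWidth K q T ^ 3 ≤ η / 2 / T := by
    rw [le_div_iff₀ hT']
    linarith
  have : η / T = η / 2 / T + η / 2 / T := by ring
  linarith

end TSE.UniformlyContinuousDensities

theorem theorem1 (K : ℕ) (hK : 2 ≤ K)
    (H : Measure (Fin K → I)) [IsProbabilityMeasure H]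
    (h : (i : Fin K) → I → ({j : Fin K // j ≠ i} → I) → ℝ)
    (h₂ : (i j : Fin K) → I × I → ({k : Fin K // k ≠ i ∧ k ≠ j} → I) → ℝ)
    (hH : TSE.UniformlyContinuousDensities H h h₂)
    (q : ℝ) (hq0 : 0 < q) (hq1 : q < 1)
    (J : (T : ℕ) → TSE.Rewards K T → Fin K)
    (hJ : ∀ T, TSE.IsRecommendation q (J T)) :
    (∀ i, Integrable (TSE.optIntegrand h i) (H.map (TSE.except i))) ∧
    (∀ T, Integrable (TSE.regret (J T)) H) ∧
    ∃ r : ℕ → ℝ, r =o[atTop] (fun T : ℕ => 1 / (T : ℝ)) ∧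
      ∀ T : ℕ, TSE.bayesRegret H (J T) ≤ TSE.optConst H h / TSE.effHorizon K q T + r T := by

  -- The remainder is the positive part of the excess over the main term, so the inequality holds
  -- for every `T`, and only the eventual bound by `η/T` has to be supplied.
  refine ⟨hH.integrable_optIntegrand, fun T => TSE.integrable_regret (J T) H,
    fun T => max (TSE.bayesRegret H (J T) - TSE.optConst H h / TSE.effHorizon K q T) 0, ?_,
    fun T => sub_le_iff_le_add'.1 (le_max_left _ _)⟩
  refine isLittleO_iff.2 fun η hη => ?_
  filter_upwards [hH.eventually_bayesRegret_le hK hq0 hq1 hJ hη] with T hT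
  rw [Real.norm_of_nonneg (le_max_right _ _), Real.norm_of_nonneg (by positivity), mul_one_div]
  exact max_le (by linarith) (by positivity)
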